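/- Let $L\ge 1$ and let $R,V,T\in\mathbb{C}^{L\times L}$. For $N\ge 1$ let $H_N$ be the $NL\times NL$ block-tridiagonal Toeplitz matrix with diagonal blocks $V$, blocks $T$ directly above and blocks $R$ directly below the diagonal, i.e. $(H_N\psi)_n=T\psi_{n+1}+V\psi_n+R\psi_{n-1}$ for $\psi=(\psi_1,\dots,\psi_N)\in(\mathbb{C}^L)^N$ and $\psi_0=\psi_{N+1}=0$. For $T$ invertible and $E\in\mathbb{C}$ let $$\mathcal{T}^E=\begin{pmatrix}(E\,\mathbf{1}-V)T^{-1}&-R\\ T^{-1}&0\end{pmatrix}$$ and let $z_1(E),\dots,z_{2L}(E)$ be its eigenvalues, listed with algebraic multiplicity so that $|z_l(E)|\le|z_{l+1}(E)|$ (ties are broken arbitrarily). Let $\mathcal{F}$ be the set of $E\in\mathbb{C}$ at which $\mathcal{T}^E$ has an eigenvalue of algebraic multiplicity at least $2$, and let $\Lambda=\{E\in\mathbb{C}: |z_L(E)|=|z_{L+1}(E)|\}$, with boundary $\partial\Lambda$. For $E\notin\mathcal{F}$ and $I\subset\{1,\dots,2L\}$ let $\mathcal{R}^E_I=\oint_{\gamma_I}\frac{dz}{2\pi\imath}(z\mathbf{1}-\mathcal{T}^E)^{-1}$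 be the Riesz projection of $\mathcal{T}^E$ onto the eigenvalues $z_i(E)$, $i\in I$ (where $\gamma_I$ winds once around each of these and not around any other eigenvalue), and let $q_I(E)$ be the determinant of the lower left $L\times L$ block of $\mathcal{R}^E_I$. Let $I_0=\{1,\dots,L\}$ and $I_1=\{1,\dots,L-1,L+1\}$. Assume: * (A) $R$ and $T$ are invertible. * (B) $\mathcal{F}$ is finite. * (C) $|z_{L-1}(E)|<|z_L(E)|=|z_{L+1}(E)|<|z_{L+2}(E)|$ for all but finitely many $E\in\partial\Lambda$ (for $L=1$ the two outer inequalities are void). * (D) For every $E_0\in\partial\Lambda\setminus\mathcal{F}$ neither $q_{I_0}$ nor $q_{I_1}$ vanishes identically in a neighbourhood of $E_0$, where near $E_0$ these functions are formed with the analytic continuation of the labelling $z_1(E_0),\dots,z_{2L}(E_0)$ of the (simple) eigenvalues at $E_0$. Then for all but finitely many $E\in\partial\Lambda$ there are constants $C>0$ and $N_0\in\mathbb{N}$ (which may depend on $E$) such that for all $N\ge N_0$ there is an $\epsilon\in\mathbb{C}$ with $|\epsilon|\le\frac{C}{N}$ such that $E+\epsilon$ is an eigenvalue of $H_N$. -/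

import Mathlib

open scoped Topology

noncomputable section

namespace BlockToeplitz

variable {L : ℕ}

/-- The `L × L` block in row `n` and column `m` of the doubly infinite block-tridiagonal operator
`(H ψ)_n = T ψ_{n+1} + V ψ_n + R ψ_{n-1}`. -/
def hamBlock (R V T : Matrix (Fin L) (Fin L) ℂ) (n m : ℤ) : Matrix (Fin L) (Fin L) ℂ :=
  if m = n + 1 then T else if m = n then V else if m = n - 1 then R else 0

/-- The compression `H_N` of `H` to `N` consecutive sites, an `NL × NL` matrix. -/
def finiteHam (R V T : Matrix (Fin L) (Fin L) ℂ) (N : ℕ) :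
    Matrix (Fin N × Fin L) (Fin N × Fin L) ℂ :=
  Matrix.of fun p q => hamBlock R V T ((p.1 : ℕ) : ℤ) ((q.1 : ℕ) : ℤ) p.2 q.2

/-- The `2L × 2L` transfer matrix at complex energy `E`. -/
def transferMatrix (R V T : Matrix (Fin L) (Fin L) ℂ) (E : ℂ) :
    Matrix (Fin L ⊕ Fin L) (Fin L ⊕ Fin L) ℂ :=
  Matrix.fromBlocks ((E • (1 : Matrix (Fin L) (Fin L) ℂ) - V) * T⁻¹) (-R) T⁻¹ 0

/-- `z 1, …, z (2 * L)` is a list of the eigenvalues of the `2L × 2L` matrix `M`, repeated according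
to algebraic multiplicity and ordered such that the moduli are nondecreasing. The values of `z` at
other indices play no role. -/
def IsOrderedEigenvalues (M : Matrix (Fin L ⊕ Fin L) (Fin L ⊕ Fin L) ℂ) (z : ℕ → ℂ) : Prop :=
  M.charpoly.roots = (Finset.Icc 1 (2 * L)).val.map z ∧
    ∀ l : ℕ, 1 ≤ l → l + 1 ≤ 2 * L → ‖z l‖ ≤ ‖z (l + 1)‖

/-- The set `F` of energies at which the transfer matrix has an eigenvalue of algebraic
multiplicity at least two. -/
def degenerateSet (R V T : Matrix (Fin L) (Fin L) ℂ) : Set ℂ :=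
  {E | ∃ w : ℂ, 2 ≤ (transferMatrix R V T E).charpoly.rootMultiplicity w}

/-- The set `Λ` of energies at which the two middle eigenvalues have the same modulus. -/
def middleSet (L : ℕ) (z : ℂ → ℕ → ℂ) : Set ℂ :=
  {E | ‖z E L‖ = ‖z E (L + 1)‖}

/-- A radius such that the closed disc around `w` contains no point of the spectrum of `M` other
than possibly `w` itself. It is positive for every `w`. -/
def contourRadius (M : Matrix (Fin L ⊕ Fin L) (Fin L ⊕ Fin L) ℂ) (w : ℂ) : ℝ :=
  (min 1 (Metric.infEDist w (spectrum ℂ M \ {w}))).toReal / 2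

/-- The Riesz projection of `M` associated to the set `S` of eigenvalues of `M`: the contour integral
`∮ (z - M)⁻¹ dz / (2πi)` along small positively oriented circles, one around each point of `S`. -/
def rieszProjection (M : Matrix (Fin L ⊕ Fin L) (Fin L ⊕ Fin L) ℂ) (S : Finset ℂ) :
    Matrix (Fin L ⊕ Fin L) (Fin L ⊕ Fin L) ℂ :=
  ∑ w ∈ S, Matrix.of fun a b =>
    (2 * Real.pi * Complex.I : ℂ)⁻¹ *
      ∮ ξ in C(w, contourRadius M w),
        ((ξ • (1 : Matrix (Fin L ⊕ Fin L) (Fin L ⊕ Fin L) ℂ) - M)⁻¹ : Matrix _ _ ℂ) a b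

/-- The function `q_I` at the energy `E` for the set of eigenvalues `S = {z_i | i ∈ I}` of the
transfer matrix at `E`: the determinant of the lower left block of the Riesz projection. -/
def qFun (R V T : Matrix (Fin L) (Fin L) ℂ) (E : ℂ) (S : Finset ℂ) : ℂ :=
  (rieszProjection (transferMatrix R V T E) S).toBlocks₂₁.det

/-- `I_0 = {1, …, L}`. -/
def indexSet0 (L : ℕ) : Finset ℕ := Finset.Icc 1 L

/-- `I_1 = {1, …, L - 1, L + 1}`. -/
def indexSet1 (L : ℕ) : Finset ℕ := insert (L + 1) (Finset.Icc 1 (L - 1))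

/-- The functions `ζ 1, …, ζ (2 * L)` continue the labelling `z 1, …, z (2 * L)` of the eigenvalues
at the energy `E₀` analytically to a neighbourhood of `E₀`. (If the eigenvalues at `E₀` are simple,
this determines the germs of these functions at `E₀`.) -/
def IsAnalyticLabelling (R V T : Matrix (Fin L) (Fin L) ℂ) (E₀ : ℂ) (z : ℕ → ℂ)
    (ζ : ℕ → ℂ → ℂ) : Prop :=
  ∀ l ∈ Finset.Icc 1 (2 * L), ζ l E₀ = z l ∧ AnalyticAt ℂ (ζ l) E₀ ∧
    ∀ᶠ E in 𝓝 E₀, ζ l E ∈ spectrum ℂ (transferMatrix R V T E)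

def HypothesisA (R T : Matrix (Fin L) (Fin L) ℂ) : Prop := IsUnit T ∧ IsUnit R

def HypothesisB (R V T : Matrix (Fin L) (Fin L) ℂ) : Prop := (degenerateSet R V T).Finite

/-- `|z_{L-1}(E)| < |z_L(E)| = |z_{L+1}(E)| < |z_{L+2}(E)|` for all but finitely many `E ∈ ∂Λ`. For
`L = 1` the outer two inequalities are void, as there are only the eigenvalues `z_1` and `z_2`. -/
def HypothesisC (L : ℕ) (z : ℂ → ℕ → ℂ) : Prop :=
  {E | E ∈ frontier (middleSet L z) ∧
    ¬ ((2 ≤ L → ‖z E (L - 1)‖ < ‖z E L‖) ∧ ‖z E L‖ = ‖z E (L + 1)‖ ∧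
      (2 ≤ L → ‖z E (L + 1)‖ < ‖z E (L + 2)‖))}.Finite

/-- Near each point of `∂Λ \ F`, the functions `q_{I_0}` and `q_{I_1}`, formed with the analytic
continuation of the labelling of the eigenvalues at that point, do not vanish identically. -/
def HypothesisD (R V T : Matrix (Fin L) (Fin L) ℂ) (z : ℂ → ℕ → ℂ) : Prop :=
  ∀ E₀ ∈ frontier (middleSet L z) \ degenerateSet R V T, ∀ ζ : ℕ → ℂ → ℂ,
    IsAnalyticLabelling R V T E₀ (z E₀) ζ →
      (¬ ∀ᶠ E in 𝓝 E₀, qFun R V T E ((indexSet0 L).image fun i => ζ i E) = 0) ∧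
      (¬ ∀ᶠ E in 𝓝 E₀, qFun R V T E ((indexSet1 L).image fun i => ζ i E) = 0)

end BlockToeplitz

end

/-!
The three-term recurrence `T ψ_{n+1} + V ψ_n + R ψ_{n-1} = E ψ_n` is propagated by the transfer matrix
`𝒯 = 𝒯^E`, so `E` is an eigenvalue of `H_N` as soon as the lower left block of `𝒯 ^ (N + 1)` is
singular (`mem_spectrum_finiteHam`). If the eigenvalues `z_i` of `𝒯` are simple, the Cauchy–Binet
formula expands the determinant of this block as `∑ I, (∏ i ∈ I, z_i) ^ (N + 1) * q_I`, the sum running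
over the sets `I` of `L` eigenvalues (`exists_blockMinor`). As the lower left block of the identity
vanishes, `q_{Iᶜ} = (-1) ^ L * q_I`.

At a point `E₀` of `∂Λ` with `|z_{L-1}| < |z_L| = |z_{L+1}| < |z_{L+2}|` exactly two of the products
`∏ i ∈ I, z_i` are dominant, those for the complements of `I_0` and `I_1`, and their quotient is
`w = z_L / z_{L+1}`. If neither `q_{I_0}` nor `q_{I_1}` nor `w'` vanishes at `E₀`, then in the variable
`s = N * (E - E₀)` the determinant, divided by one dominant term, is close to a multiple of
`1 - exp (c * (s - s_N))` with `c = w' / w` and bounded `s_N`, and a Hurwitz argument gives a zero at a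
bounded value of `s` (`exists_zero_near_of_two_dominant_terms`).

It remains to see that only finitely many points of `∂Λ` are lost. Up to nonzero factors `q_{I_0}`,
`q_{I_1}` and `w'` are polynomials in `E` and the eigenvalues. For such a polynomial `G` the product of
`Y - G(z_{τ(1)}, …, z_{τ(2L)}, E)` over all permutations `τ` has coefficients that are polynomials in
`E`, by the fundamental theorem of symmetric polynomials; hence the number of `τ` at which `G` vanishes
is the same for all but finitely many `E`, and off these `E` a zero of `G` persists in a neighbourhood
(`exists_finite_forall_eventually_evalAt_eq_zero`). For `q_{I_0}` and `q_{I_1}` this is excluded by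
hypothesis, and for `w'` because `w` would be locally constant of modulus one, so that `E₀` would be an
interior point of `Λ` (`not_eventually_deriv_div_eq_zero`).
-/

/-! ### Functional calculus and Riesz projections of matrices with simple spectrum -/

namespace BlockToeplitz

open Matrix

section CauchyBinet

variable {m n K : Type*} [Fintype m] [DecidableEq m] [Fintype n] [DecidableEq n] [CommRing K]

/-- A form of the Cauchy–Binet formula for `det (A * diagonal c * B)`: it is a sum over the subsets
of size `card m`, and the coefficients do not depend on `c`. -/
theorem exists_det_mul_diagonal_mul (A : Matrix m n K) (B : Matrix n m K) :
    ∃ a : Finset n → K, ∀ c : n → K, (A * diagonal c * B).det =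
      ∑ I ∈ Finset.powersetCard (Fintype.card m) Finset.univ, (∏ i ∈ I, c i) * a I := by
  classical
  refine ⟨fun I => ∑ r : m → n with Function.Injective r ∧ Finset.univ.image r = I,
    (∏ k, A k (r k)) * (B.submatrix r id).det, fun c => ?_⟩
  have h1 : (A * diagonal c * B).det =
      ∑ r : m → n, (∏ k, A k (r k) * c (r k)) * (B.submatrix r id).det := by
    have hrow : A * diagonal c * B = fun k => ∑ i : n, (A k i * c i) • B i := by
      ext k l
      rw [Matrix.mul_apply]
      simp [mul_diagonal, Finset.sum_apply]
    have := MultilinearMap.map_sum (detRowAlternating (n := m) (R := K)).toMultilinearMap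
      (fun (k : m) (i : n) => (A k i * c i) • B i)
    simp only [AlternatingMap.coe_multilinearMap] at this
    rw [hrow]
    refine this.trans (Finset.sum_congr rfl fun r _ => ?_)
    rw [AlternatingMap.map_smul_univ (detRowAlternating (n := m) (R := K))
      (fun k => A k (r k) * c (r k)) (fun k => B (r k)), smul_eq_mul]
    rfl
  have h2 : (A * diagonal c * B).det =
      ∑ r : m → n with Function.Injective r,
        (∏ k, A k (r k) * c (r k)) * (B.submatrix r id).det := by
    rw [h1, Finset.sum_filter]
    refine Finset.sum_congr rfl fun r _ => ?_
    split_ifs with hr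
    · rfl
    · obtain ⟨i, j, hij, hne⟩ : ∃ i j, r i = r j ∧ i ≠ j := by
        simpa [Function.Injective] using hr
      rw [det_zero_of_row_eq hne (by ext l; simp [hij]), mul_zero]
  rw [h2, ← Finset.sum_fiberwise_of_maps_to (t := Finset.powersetCard (Fintype.card m) Finset.univ)
    (g := fun r : m → n => Finset.univ.image r)]
  · refine Finset.sum_congr rfl fun I _ => ?_
    rw [Finset.filter_filter, Finset.mul_sum]
    refine Finset.sum_congr rfl fun r hr => ?_
    obtain ⟨hinj, himg⟩ := (Finset.mem_filter.mp hr).2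
    rw [← himg, Finset.prod_image (fun _ _ _ _ h => hinj h), Finset.prod_mul_distrib]
    ring
  · intro r hr
    rw [Finset.mem_powersetCard]
    refine ⟨Finset.subset_univ _, ?_⟩
    rw [Finset.card_image_of_injective _ (Finset.mem_filter.mp hr).2, Finset.card_univ]

end CauchyBinet

section Diagonalization

variable {n : Type*} [Fintype n] [DecidableEq n]

theorem exists_isUnit_eq_mul_diagonal_mul_inv (M : Matrix n n ℂ) {μ : n → ℂ}
    (hinj : Function.Injective μ) (hμ : ∀ i, μ i ∈ spectrum ℂ M) :
    ∃ U : Matrix n n ℂ, IsUnit U ∧ M = U * diagonal μ * U⁻¹ := by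
  have hev : ∀ i, ∃ v, Module.End.HasEigenvector (Matrix.toLin' M) (μ i) v := fun i => by
    have : Module.End.HasEigenvalue (Matrix.toLin' M) (μ i) := by
      rw [Module.End.hasEigenvalue_iff_mem_spectrum, spectrum_toLin']
      exact hμ i
    exact this.exists_hasEigenvector
  choose v hv using hev
  have hli := Module.End.eigenvectors_linearIndependent' _ μ hinj v hv
  let U : Matrix n n ℂ := Matrix.of fun a i => v i a
  have hU : IsUnit U := by
    rw [← linearIndependent_cols_iff_isUnit]
    exact hli
  refine ⟨U, hU, ?_⟩
  have hMU : M * U = U * diagonal μ := by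
    ext a i
    have := congrFun ((hv i).apply_eq_smul) a
    simp only [toLin'_apply, Pi.smul_apply, smul_eq_mul, mulVec, dotProduct] at this
    rw [mul_diagonal, Matrix.mul_apply]
    simp [U, this, mul_comm]
  rw [← hMU, Matrix.mul_assoc, mul_nonsing_inv _ ((isUnit_iff_isUnit_det U).mp hU), mul_one]

/-- The algebra homomorphism `c ↦ U * diagonal c * U⁻¹`, the functional calculus of the matrices
that are diagonal in the basis given by the columns of `U`. -/
noncomputable def conjDiagonal (U : Matrix n n ℂ) (hU : IsUnit U) :
    (n → ℂ) →ₐ[ℂ] Matrix n n ℂ :=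
  AlgHom.ofLinearMap
    { toFun := fun c => U * diagonal c * U⁻¹
      map_add' := fun c d => by
        rw [← Matrix.add_mul, ← Matrix.mul_add, diagonal_add]; rfl
      map_smul' := fun s c => by
        simp [diagonal_smul] }
    (by simp [mul_nonsing_inv _ ((isUnit_iff_isUnit_det U).mp hU)])
    (fun c d => by
      have h := nonsing_inv_mul _ ((isUnit_iff_isUnit_det U).mp hU)
      change U * diagonal (c * d) * U⁻¹ = U * diagonal c * U⁻¹ * (U * diagonal d * U⁻¹)
      rw [show U * diagonal c * U⁻¹ * (U * diagonal d * U⁻¹) =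
        U * diagonal c * (U⁻¹ * U) * diagonal d * U⁻¹ by simp only [Matrix.mul_assoc], h,
        Matrix.mul_one, Matrix.mul_assoc U (diagonal c), diagonal_mul_diagonal]
      rfl)

theorem conjDiagonal_apply (U : Matrix n n ℂ) (hU : IsUnit U) (c : n → ℂ) :
    conjDiagonal U hU c = U * diagonal c * U⁻¹ := rfl

theorem aeval_conjDiagonal (U : Matrix n n ℂ) (hU : IsUnit U) (μ : n → ℂ) (p : Polynomial ℂ) :
    Polynomial.aeval (conjDiagonal U hU μ) p = conjDiagonal U hU fun i => p.eval (μ i) := by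
  rw [Polynomial.aeval_algHom_apply]
  congr 1
  ext i
  simp [Polynomial.coe_aeval_eq_eval]

theorem inv_smul_one_sub_conjDiagonal (U : Matrix n n ℂ) (hU : IsUnit U) (μ : n → ℂ) {ξ : ℂ}
    (hξ : ∀ i, ξ ≠ μ i) :
    (ξ • (1 : Matrix n n ℂ) - conjDiagonal U hU μ)⁻¹ =
      conjDiagonal U hU fun i => (ξ - μ i)⁻¹ := by
  apply inv_eq_right_inv
  rw [← map_one (conjDiagonal U hU), ← map_smul, ← map_sub, ← map_mul]
  congr 1
  ext i
  simpa using mul_inv_cancel₀ (sub_ne_zero.mpr (hξ i))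

end Diagonalization

variable {L : ℕ}

theorem contourRadius_pos (M : Matrix (Fin L ⊕ Fin L) (Fin L ⊕ Fin L) ℂ) (w : ℂ) :
    0 < contourRadius M w := by
  have hfin : (spectrum ℂ M \ {w}).Finite := M.finite_spectrum.subset Set.sdiff_subset
  have h : 0 < Metric.infEDist w (spectrum ℂ M \ {w}) := by
    rw [Metric.infEDist_pos_iff_notMem_closure, hfin.isClosed.closure_eq]
    simp
  refine half_pos (ENNReal.toReal_pos (lt_min one_pos h).ne' ?_)
  exact ((min_le_left _ _).trans_lt ENNReal.one_lt_top).ne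

theorem contourRadius_lt_dist (M : Matrix (Fin L ⊕ Fin L) (Fin L ⊕ Fin L) ℂ) {w v : ℂ}
    (hv : v ∈ spectrum ℂ M) (hne : v ≠ w) : contourRadius M w < dist v w := by
  have h1 : (min 1 (Metric.infEDist w (spectrum ℂ M \ {w}))).toReal ≤ dist w v := by
    rw [← ENNReal.toReal_ofReal (dist_nonneg (x := w) (y := v)), ← edist_dist]
    exact ENNReal.toReal_mono (edist_ne_top _ _)
      ((min_le_right _ _).trans (Metric.infEDist_le_edist_of_mem ⟨hv, hne⟩))
  have h2 := contourRadius_pos M w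
  rw [dist_comm]
  unfold contourRadius at *
  linarith

/-- The Riesz projection of a matrix with simple spectrum is diagonal in the eigenbasis. -/
theorem rieszProjection_conjDiagonal (U : Matrix (Fin L ⊕ Fin L) (Fin L ⊕ Fin L) ℂ)
    (hU : IsUnit U) {μ : Fin L ⊕ Fin L → ℂ} (hinj : Function.Injective μ)
    (hμ : ∀ i, μ i ∈ spectrum ℂ (conjDiagonal U hU μ)) (S : Finset (Fin L ⊕ Fin L)) :
    rieszProjection (conjDiagonal U hU μ) (S.image μ) =
      conjDiagonal U hU fun i => if i ∈ S then 1 else 0 := by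
  set M := conjDiagonal U hU μ with hM
  have key : ∀ k : Fin L ⊕ Fin L, (Matrix.of fun a b => (2 * Real.pi * Complex.I : ℂ)⁻¹ *
      ∮ ξ in C(μ k, contourRadius M (μ k)), ((ξ • (1 : Matrix (Fin L ⊕ Fin L) (Fin L ⊕ Fin L) ℂ)
        - M)⁻¹ : Matrix _ _ ℂ) a b) = conjDiagonal U hU (Pi.single k 1) := by
    intro k
    have hr := contourRadius_pos M (μ k)
    -- No eigenvalue lies on the circle around `μ k`.
    have hoff : ∀ ξ ∈ Metric.sphere (μ k) (contourRadius M (μ k)), ∀ i, ξ ≠ μ i := by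
      rintro ξ hξ i rfl
      rw [Metric.mem_sphere] at hξ
      by_cases hik : μ i = μ k
      · rw [hik, dist_self] at hξ
        exact hr.ne hξ
      · exact (contourRadius_lt_dist M (hμ i) hik).ne' hξ
    have hint : ∀ i, (∮ ξ in C(μ k, contourRadius M (μ k)), (ξ - μ i)⁻¹) =
        (2 * Real.pi * Complex.I : ℂ) * (Pi.single k 1 : Fin L ⊕ Fin L → ℂ) i := by
      intro i
      rcases eq_or_ne i k with rfl | hik
      · rw [circleIntegral.integral_sub_inv_of_mem_ball (Metric.mem_ball_self hr)]
        simp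
      · rw [Pi.single_eq_of_ne hik, mul_zero]
        refine DiffContOnCl.circleIntegral_eq_zero hr.le ?_
        refine DifferentiableOn.diffContOnCl fun ξ hξ => ?_
        rw [closure_ball _ hr.ne'] at hξ
        have : ξ ≠ μ i := by
          rintro rfl
          exact absurd (Metric.mem_closedBall.mp hξ)
            (not_le.mpr (contourRadius_lt_dist M (hμ i) (hinj.ne hik)))
        have hne := sub_ne_zero.mpr this
        fun_prop (disch := assumption)
    ext a b
    have hentry : ∀ c : Fin L ⊕ Fin L → ℂ, conjDiagonal U hU c a b =
        ∑ i, (U a i * U⁻¹ i b) * c i := by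
      intro c
      rw [conjDiagonal_apply, Matrix.mul_apply]
      exact Finset.sum_congr rfl fun i _ => by rw [mul_diagonal]; ring
    have hcong : (∮ ξ in C(μ k, contourRadius M (μ k)),
        ((ξ • (1 : Matrix (Fin L ⊕ Fin L) (Fin L ⊕ Fin L) ℂ) - M)⁻¹ : Matrix _ _ ℂ) a b) =
        ∮ ξ in C(μ k, contourRadius M (μ k)), ∑ i, (U a i * U⁻¹ i b) * (ξ - μ i)⁻¹ := by
      refine circleIntegral.integral_congr hr.le fun ξ hξ => ?_
      rw [hM, inv_smul_one_sub_conjDiagonal U hU μ (hoff ξ hξ), hentry]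
    rw [of_apply, hcong, circleIntegral.integral_fun_sum, hentry, Finset.mul_sum]
    · refine Finset.sum_congr rfl fun i _ => ?_
      rw [circleIntegral.integral_const_mul, hint]
      have : (2 * Real.pi * Complex.I : ℂ) ≠ 0 := Complex.two_pi_I_ne_zero
      field_simp
    · intro i _
      refine ContinuousOn.circleIntegrable hr.le fun ξ hξ => ?_
      exact (((continuousAt_id.sub continuousAt_const).inv₀
        (sub_ne_zero.mpr (hoff ξ hξ i))).const_mul _).continuousWithinAt
  unfold rieszProjection
  rw [Finset.sum_image (fun _ _ _ _ h => hinj h), Finset.sum_congr rfl fun k _ => key k, ← map_sum]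
  congr 1
  ext i
  simp [Finset.sum_apply, Pi.single_apply]

theorem prod_eq_zero_of_card_eq_of_ne {n : Type*} [DecidableEq n] {I S : Finset n}
    (hcard : I.card = S.card) {c : n → ℂ} (hc : ∀ i, i ∉ S → c i = 0) (hne : I ≠ S) :
    ∏ i ∈ I, c i = 0 := by
  have : ¬ I ⊆ S := fun h => hne (Finset.eq_of_subset_of_card_le h hcard.ge)
  obtain ⟨i, hi, hiS⟩ := Finset.not_subset.mp this
  exact Finset.prod_eq_zero hi (hc i hiS)

/-- For a matrix `M` with simple spectrum `μ` there are coefficients `a S`, indexed by the sets `S`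
of `L` eigenvalues, that give the determinant of the lower left block of every polynomial in `M`.
They are the determinants of the lower left blocks of the Riesz projections. -/
theorem exists_blockMinor (M : Matrix (Fin L ⊕ Fin L) (Fin L ⊕ Fin L) ℂ) {μ : Fin L ⊕ Fin L → ℂ}
    (hinj : Function.Injective μ) (hμ : ∀ i, μ i ∈ spectrum ℂ M) :
    ∃ a : Finset (Fin L ⊕ Fin L) → ℂ,
      (∀ p : Polynomial ℂ, (Polynomial.aeval M p).toBlocks₂₁.det =
        ∑ I ∈ Finset.powersetCard L Finset.univ, (∏ i ∈ I, p.eval (μ i)) * a I) ∧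
      (∀ S : Finset (Fin L ⊕ Fin L), S.card = L →
        (rieszProjection M (S.image μ)).toBlocks₂₁.det = a S) ∧
      ∀ S : Finset (Fin L ⊕ Fin L), S.card = L → a Sᶜ = (-1) ^ L * a S := by
  obtain ⟨U, hU, hM⟩ := exists_isUnit_eq_mul_diagonal_mul_inv M hinj hμ
  replace hM : M = conjDiagonal U hU μ := hM
  obtain ⟨a, ha⟩ := exists_det_mul_diagonal_mul (U.submatrix Sum.inr id)
    (U⁻¹.submatrix id (Sum.inl : Fin L → Fin L ⊕ Fin L))
  have ha' : ∀ c, (conjDiagonal U hU c).toBlocks₂₁.det =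
      ∑ I ∈ Finset.powersetCard L Finset.univ, (∏ i ∈ I, c i) * a I := by
    intro c
    have h := ha c
    rw [Fintype.card_fin] at h
    rw [← h]
    rfl
  have hind : ∀ S : Finset (Fin L ⊕ Fin L), S.card = L →
      (conjDiagonal U hU fun i => if i ∈ S then 1 else 0).toBlocks₂₁.det = a S := by
    intro S hS
    rw [ha', Finset.sum_eq_single S]
    · rw [Finset.prod_eq_one fun i hi => by simp [hi], one_mul]
    · intro I hI hne
      rw [prod_eq_zero_of_card_eq_of_ne ((Finset.mem_powersetCard.mp hI).2.trans hS.symm)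
        (fun i hi => by simp [hi]) hne, zero_mul]
    · intro h
      exact absurd (Finset.mem_powersetCard.mpr ⟨Finset.subset_univ S, hS⟩) h
  refine ⟨a, fun p => ?_, fun S hS => ?_, fun S hS => ?_⟩
  · rw [hM, aeval_conjDiagonal, ha']
  · rw [← hind S hS, hM, rieszProjection_conjDiagonal U hU hinj (hM ▸ hμ)]
  · have hS' : Sᶜ.card = L := by
      rw [Finset.card_compl, hS]
      simp
    have hsum : (fun i => if i ∈ Sᶜ then (1 : ℂ) else 0) =
        1 - fun i => if i ∈ S then (1 : ℂ) else 0 := by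
      ext i
      by_cases hi : i ∈ S <;> simp [hi]
    -- The lower left block of the identity matrix vanishes.
    have hblock : (conjDiagonal U hU fun i => if i ∈ Sᶜ then 1 else 0).toBlocks₂₁ =
        -(conjDiagonal U hU fun i => if i ∈ S then 1 else 0).toBlocks₂₁ := by
      rw [hsum, map_sub, map_one]
      ext k l
      simp [toBlocks₂₁]
    rw [← hind S hS, ← hind Sᶜ hS', hblock, det_neg, Fintype.card_fin]

end BlockToeplitz

/-! ### The transfer matrix and the spectrum of the finite system -/

namespace BlockToeplitz

open Matrix

variable {L : ℕ}

theorem transferMatrix_mulVec (R V T : Matrix (Fin L) (Fin L) ℂ) (E : ℂ)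
    (x : Fin L ⊕ Fin L → ℂ) :
    transferMatrix R V T E *ᵥ x =
      Sum.elim (((E • (1 : Matrix (Fin L) (Fin L) ℂ) - V) * T⁻¹) *ᵥ (x ∘ Sum.inl)
        - R *ᵥ (x ∘ Sum.inr)) (T⁻¹ *ᵥ (x ∘ Sum.inl)) := by
  rw [transferMatrix, fromBlocks_mulVec]
  simp [neg_mulVec, sub_eq_add_neg]

theorem zero_notMem_spectrum_transferMatrix {R T : Matrix (Fin L) (Fin L) ℂ}
    (V : Matrix (Fin L) (Fin L) ℂ) (hA : HypothesisA R T) (E : ℂ) :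
    (0 : ℂ) ∉ spectrum ℂ (transferMatrix R V T E) := by
  rw [spectrum.zero_notMem_iff, ← mulVec_injective_iff_isUnit]
  have hT : Function.Injective (T⁻¹).mulVec :=
    mulVec_injective_iff_isUnit.mpr ((isUnit_nonsing_inv_iff).mpr hA.1)
  have hR : Function.Injective R.mulVec := mulVec_injective_iff_isUnit.mpr hA.2
  intro x y hxy
  simp only [transferMatrix_mulVec] at hxy
  have h2 : x ∘ Sum.inl = y ∘ Sum.inl := by
    apply hT
    funext i
    simpa using congrFun hxy (Sum.inr i)
  have h1 : x ∘ Sum.inr = y ∘ Sum.inr := by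
    apply hR
    funext i
    simpa [h2] using congrFun hxy (Sum.inl i)
  funext i
  rcases i with i | i
  · exact congrFun h2 i
  · exact congrFun h1 i

/-- If `ψ` solves the three-term recurrence with Dirichlet conditions at the sites `0` and `N + 1`,
then its restriction to the sites `1, …, N` satisfies the eigenvalue equation of `H_N`. -/
theorem finiteHam_mulVec {R V T : Matrix (Fin L) (Fin L) ℂ} {E : ℂ} {N : ℕ}
    {ψ : ℕ → Fin L → ℂ} (h0 : ψ 0 = 0) (hN : ψ (N + 1) = 0)
    (hrec : ∀ k, T *ᵥ ψ (k + 2) + V *ᵥ ψ (k + 1) + R *ᵥ ψ k = E • ψ (k + 1)) :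
    finiteHam R V T N *ᵥ (fun p => ψ (p.1 + 1) p.2) = E • fun p => ψ (p.1 + 1) p.2 := by
  funext p
  obtain ⟨k, i⟩ := p
  have h1 : (finiteHam R V T N *ᵥ fun p => ψ (p.1 + 1) p.2) (k, i) =
      ∑ m ∈ Finset.range N, (hamBlock R V T (k : ℕ) (m : ℕ) *ᵥ ψ (m + 1)) i := by
    rw [← Fin.sum_univ_eq_sum_range
      (fun m => (hamBlock R V T (k : ℕ) (m : ℕ) *ᵥ ψ (m + 1)) i) N, mulVec, dotProduct,
      Fintype.sum_prod_type]
    rfl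
  have h2 : ∀ m : ℕ, hamBlock R V T ((k : ℕ) : ℤ) (m : ℕ) *ᵥ ψ (m + 1) =
      (if m = (k : ℕ) + 1 then T *ᵥ ψ (m + 1) else 0) +
        (if m = (k : ℕ) then V *ᵥ ψ (m + 1) else 0) +
        (if m + 1 = (k : ℕ) then R *ᵥ ψ (m + 1) else 0) := by
    intro m
    unfold hamBlock
    by_cases ha : m = (k : ℕ) + 1
    · have hb : ¬ m = (k : ℕ) := by omega
      have hc : ¬ m + 1 = (k : ℕ) := by omega
      rw [if_pos (by omega), if_pos ha, if_neg hb, if_neg hc, add_zero, add_zero]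
    by_cases hb : m = (k : ℕ)
    · have hc : ¬ m + 1 = (k : ℕ) := by omega
      rw [if_neg (by omega), if_pos (by omega), if_neg ha, if_pos hb, if_neg hc, add_zero, zero_add]
    by_cases hc : m + 1 = (k : ℕ)
    · rw [if_neg (by omega), if_neg (by omega), if_pos (by omega), if_neg ha, if_neg hb, if_pos hc,
        add_zero, zero_add]
    · rw [if_neg (by omega), if_neg (by omega), if_neg (by omega), if_neg ha, if_neg hb, if_neg hc,
        zero_mulVec, add_zero, add_zero]
  have h3 : ∑ m ∈ Finset.range N, hamBlock R V T ((k : ℕ) : ℤ) (m : ℕ) *ᵥ ψ (m + 1) =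
      T *ᵥ ψ (k + 2) + V *ᵥ ψ (k + 1) + R *ᵥ ψ k := by
    have hk := k.isLt
    rw [Finset.sum_congr rfl fun m _ => h2 m, Finset.sum_add_distrib, Finset.sum_add_distrib]
    congr 1
    · congr 1
      · rw [Finset.sum_ite_eq']
        split_ifs with h
        · rfl
        · have : (k : ℕ) + 2 = N + 1 := by
            rw [Finset.mem_range] at h
            omega
          rw [this, hN, mulVec_zero]
      · rw [Finset.sum_ite_eq', if_pos (Finset.mem_range.mpr hk)]
    · rcases Nat.eq_zero_or_pos (k : ℕ) with h | h
      · rw [h, h0, mulVec_zero]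
        exact Finset.sum_eq_zero fun m _ => if_neg (by omega)
      · rw [Finset.sum_eq_single ((k : ℕ) - 1)]
        · rw [if_pos (by omega), Nat.sub_add_cancel h]
        · intro m _ hm
          exact if_neg (by omega)
        · intro hm
          exact absurd (Finset.mem_range.mpr (by omega)) hm
  rw [h1, ← Finset.sum_apply, h3, hrec]
  rfl

/-- The transfer matrix propagates solutions of the three-term recurrence, hence an energy at which
the lower left block of its power `N + 1` is singular is an eigenvalue of `H_N`. -/
theorem mem_spectrum_finiteHam {R V T : Matrix (Fin L) (Fin L) ℂ} (hT : IsUnit T) {E : ℂ} {N : ℕ}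
    (hN : 1 ≤ N) (hdet : ((transferMatrix R V T E) ^ (N + 1)).toBlocks₂₁.det = 0) :
    E ∈ spectrum ℂ (finiteHam R V T N) := by
  obtain ⟨v, hv, hv0⟩ := exists_mulVec_eq_zero_iff.mpr hdet
  have hTdet := (isUnit_iff_isUnit_det T).mp hT
  let Φ : ℕ → Fin L ⊕ Fin L → ℂ := fun k => transferMatrix R V T E ^ k *ᵥ Sum.elim v 0
  let ψ : ℕ → Fin L → ℂ := fun k => Φ k ∘ Sum.inr
  let u : ℕ → Fin L → ℂ := fun k => Φ k ∘ Sum.inl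
  have hΦ : ∀ k, Φ (k + 1) = transferMatrix R V T E *ᵥ Φ k := fun k => by
    simp only [Φ, pow_succ', mulVec_mulVec]
  have hψ : ∀ k, ψ (k + 1) = T⁻¹ *ᵥ u k := fun k => by
    funext i
    simp only [ψ, u, Function.comp, hΦ k, transferMatrix_mulVec, Sum.elim_inr]
  have hu : ∀ k, u (k + 1) =
      ((E • (1 : Matrix (Fin L) (Fin L) ℂ) - V) * T⁻¹) *ᵥ u k - R *ᵥ ψ k := fun k => by
    funext i
    simp only [ψ, u, Function.comp, hΦ k, transferMatrix_mulVec, Sum.elim_inl]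
  have hψ0 : ψ 0 = 0 := by
    funext i
    simp [ψ, Φ]
  have hψN : ψ (N + 1) = 0 := by
    rw [← hv0]
    funext i
    simp only [ψ, Φ, Function.comp, mulVec, dotProduct, Fintype.sum_sum_type]
    simp [toBlocks₂₁]
  have hTu : ∀ k, T *ᵥ ψ (k + 1) = u k := fun k => by
    rw [hψ, mulVec_mulVec, mul_nonsing_inv _ hTdet, one_mulVec]
  have hrec : ∀ k, T *ᵥ ψ (k + 2) + V *ᵥ ψ (k + 1) + R *ᵥ ψ k = E • ψ (k + 1) := by
    intro k
    rw [hTu (k + 1), hu, ← mulVec_mulVec, ← hψ, sub_mulVec, smul_mulVec, one_mulVec]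
    abel
  have hψ1 : ψ 1 ≠ 0 := by
    intro h
    apply hv
    have h0 := hTu 0
    rw [zero_add, h, mulVec_zero] at h0
    funext i
    have := congrFun h0 i
    simpa [u, Φ] using this.symm
  rw [← spectrum_toLin', ← Module.End.hasEigenvalue_iff_mem_spectrum]
  refine Module.End.hasEigenvalue_of_hasEigenvector
    (x := fun p : Fin N × Fin L => ψ (p.1 + 1) p.2) ⟨?_, ?_⟩
  · rw [Module.End.mem_eigenspace_iff, toLin'_apply]
    exact finiteHam_mulVec hψ0 hψN hrec
  · intro h
    apply hψ1
    funext i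
    exact congrFun h (⟨0, hN⟩, i)

end BlockToeplitz

/-! ### Zeros of a sum of two dominant exponentials -/

namespace BlockToeplitz

open Filter Metric

/-- A quantitative Hurwitz argument: a holomorphic function that is close, on a disc, to
`t ↦ a * (1 - exp (c * t))` has a zero in that disc. -/
theorem exists_zero_of_close_to_exp {G : ℂ → ℂ} {a c : ℂ} (ha : a ≠ 0) (hc : c ≠ 0)
    (hG : DifferentiableOn ℂ G (ball 0 (‖c‖⁻¹)))
    (hclose : ∀ t ∈ ball (0 : ℂ) (‖c‖⁻¹), ‖G t - a * (1 - Complex.exp (c * t))‖ ≤ ‖a‖ / 32) :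
    ∃ t ∈ closedBall (0 : ℂ) (‖c‖⁻¹ / 2), G t = 0 := by
  have hcpos : 0 < ‖c‖⁻¹ := inv_pos.mpr (norm_pos_iff.mpr hc)
  have hapos : 0 < ‖a‖ := norm_pos_iff.mpr ha
  have hG0 : ‖G 0‖ ≤ ‖a‖ / 32 := by simpa using hclose 0 (mem_ball_self hcpos)
  have hsub : closedBall (0 : ℂ) (‖c‖⁻¹ / 2) ⊆ ball 0 (‖c‖⁻¹) :=
    closedBall_subset_ball (half_lt_self hcpos)
  have hsphere : ∀ t ∈ sphere (0 : ℂ) (‖c‖⁻¹ / 2), ‖a‖ * (3 / 16) ≤ ‖G t - G 0‖ := by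
    intro t ht
    have hct : ‖c * t‖ = 1 / 2 := by
      rw [norm_mul, mem_sphere_zero_iff_norm.mp ht]
      field_simp
    have h1 : 1 / 4 ≤ ‖1 - Complex.exp (c * t)‖ := by
      have h := Complex.norm_exp_sub_one_sub_id_le (x := c * t) (by rw [hct]; norm_num)
      have h' := norm_sub_norm_le (c * t) (Complex.exp (c * t) - 1)
      rw [norm_sub_rev] at h h'
      rw [norm_sub_rev]
      have h'' : ‖c * t - (Complex.exp (c * t) - 1)‖ ≤ (1 / 2) ^ 2 := by rw [← hct]; exact h
      rw [norm_sub_rev] at h'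
      linarith
    have h2 := hclose t (hsub (sphere_subset_closedBall ht))
    have h3 : ‖a‖ * (1 / 4) ≤ ‖a * (1 - Complex.exp (c * t))‖ := by
      rw [norm_mul]
      gcongr
    have h4 : a * (1 - Complex.exp (c * t)) =
        (G t - G 0) - (G t - a * (1 - Complex.exp (c * t))) + G 0 := by ring
    have h5 : ‖a * (1 - Complex.exp (c * t))‖ ≤ ‖G t - G 0‖ + ‖a‖ / 32 + ‖a‖ / 32 := by
      rw [h4]
      refine (norm_add_le _ _).trans ?_
      gcongr
      refine (norm_sub_le _ _).trans ?_
      gcongr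
    linarith
  have hfreq : ∃ᶠ t in 𝓝 (0 : ℂ), G t ≠ G 0 := by
    intro hcon
    have hcon' : G =ᶠ[𝓝 0] fun _ => G 0 := hcon.mono fun t ht => not_not.mp ht
    have heq := (hG.analyticOnNhd isOpen_ball).eqOn_of_preconnected_of_eventuallyEq
      analyticOnNhd_const (convex_ball _ _).isPreconnected (mem_ball_self hcpos) hcon'
    have hmem : ((‖c‖⁻¹ / 2 : ℝ) : ℂ) ∈ sphere (0 : ℂ) (‖c‖⁻¹ / 2) := by
      rw [mem_sphere_zero_iff_norm, Complex.norm_real, Real.norm_of_nonneg (by positivity)]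
    have h := hsphere _ hmem
    rw [heq (hsub (sphere_subset_closedBall hmem)), sub_self, norm_zero] at h
    linarith
  have himg := DiffContOnCl.ball_subset_image_closedBall (z₀ := (0 : ℂ)) (r := ‖c‖⁻¹ / 2)
    ((hG.mono (closure_ball_subset_closedBall.trans hsub)).diffContOnCl) (by positivity)
    hsphere hfreq
  have h0 : (0 : ℂ) ∈ ball (G 0) (‖a‖ * (3 / 16) / 2) := by
    rw [mem_ball, dist_zero_left]
    linarith
  obtain ⟨t, ht, hGt⟩ := himg h0
  exact ⟨t, ht, hGt⟩

/-- If two dominant terms have equal modulus at `E₀` and their quotient `w` has a nonzero derivative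
there, then `a + w ^ N * b`, up to a perturbation that vanishes locally uniformly, has a zero at
distance `O(1 / N)` from `E₀`. The zero is found in the variable `N * (E - E₀)`, in which the
function approaches a multiple of an exponential minus one. -/
theorem exists_zero_near_of_two_dominant_terms {F : ℕ → ℂ → ℂ} {a b w : ℂ → ℂ} {E₀ w' : ℂ}
    (hF : ∀ᶠ E in 𝓝 E₀, ∀ N, DifferentiableAt ℂ (F N) E)
    (hrem : Tendsto (fun p : ℕ × ℂ => F p.1 p.2 - (a p.2 + w p.2 ^ p.1 * b p.2))
      (atTop ×ˢ 𝓝 E₀) (𝓝 0))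
    (ha : ContinuousAt a E₀) (hb : ContinuousAt b E₀) (ha0 : a E₀ ≠ 0) (hb0 : b E₀ ≠ 0)
    (hw0 : ‖w E₀‖ = 1) (hw : HasDerivAt w w' E₀) (hw' : w' ≠ 0) :
    ∃ C : ℝ, 0 < C ∧ ∃ N₀ : ℕ, ∀ N : ℕ, N₀ ≤ N →
      ∃ ε : ℂ, ‖ε‖ ≤ C / (N : ℝ) ∧ F N (E₀ + ε) = 0 := by
  have hwne : w E₀ ≠ 0 := by
    rw [← norm_pos_iff, hw0]
    exact one_pos
  set c := w' / w E₀ with hc_def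
  have hc : c ≠ 0 := div_ne_zero hw' hwne
  have hcpos : 0 < ‖c‖⁻¹ := inv_pos.mpr (norm_pos_iff.mpr hc)
  -- A local logarithm of `w / w E₀`.
  let ℓ : ℂ → ℂ := fun h => Complex.log (w (E₀ + h) / w E₀)
  have hshift : HasDerivAt (fun h => w (E₀ + h)) w' 0 := by
    have : HasDerivAt w w' (E₀ + 0) := by rwa [add_zero]
    exact this.comp_const_add E₀ 0
  have hℓ0 : ℓ 0 = 0 := by simp [ℓ, div_self hwne]
  have hℓ : HasDerivAt ℓ c 0 := by
    have h := (hshift.div_const (w E₀)).clog (by simp [div_self hwne])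
    simpa [div_self hwne] using h
  have hexp : ∀ᶠ h in 𝓝 (0 : ℂ), w (E₀ + h) = w E₀ * Complex.exp (ℓ h) := by
    have : ∀ᶠ h in 𝓝 (0 : ℂ), w (E₀ + h) ≠ 0 :=
      hshift.continuousAt.eventually_ne (by simpa using hwne)
    filter_upwards [this] with h hh
    rw [Complex.exp_log (div_ne_zero hh hwne), mul_div_cancel₀ _ hwne]
  -- The zeros of the limiting function `a E₀ + w E₀ ^ N * exp (c * s) * b E₀`.
  let q : ℕ → ℂ := fun N => -(a E₀) / (b E₀ * w E₀ ^ N)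
  have hq : ∀ N, q N ≠ 0 := fun N =>
    div_ne_zero (neg_ne_zero.mpr ha0) (mul_ne_zero hb0 (pow_ne_zero _ hwne))
  let s : ℕ → ℂ := fun N => Complex.log (q N) / c
  have hs : ∀ N, w E₀ ^ N * Complex.exp (c * s N) = -(a E₀) / b E₀ := by
    intro N
    have hwN : w E₀ ^ N ≠ 0 := pow_ne_zero _ hwne
    simp only [s]
    rw [mul_div_cancel₀ _ hc, Complex.exp_log (hq N)]
    simp only [q]
    field_simp
  obtain ⟨S, hS0, hS⟩ : ∃ S : ℝ, 0 ≤ S ∧ ∀ N, ‖s N‖ ≤ S := by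
    refine ⟨(|Real.log (‖a E₀‖ / ‖b E₀‖)| + Real.pi) / ‖c‖,
      div_nonneg (add_nonneg (abs_nonneg _) Real.pi_pos.le) (norm_nonneg _), fun N => ?_⟩
    simp only [s]
    rw [norm_div]
    gcongr
    refine (Complex.norm_le_abs_re_add_abs_im _).trans (add_le_add ?_ ?_)
    · have : ‖q N‖ = ‖a E₀‖ / ‖b E₀‖ := by simp [q, hw0]
      rw [Complex.log_re, this]
    · rw [Complex.log_im]
      exact Complex.abs_arg_le_pi _
  -- All limits below are uniform in `t` in the disc of radius `‖c‖⁻¹`.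
  let l : Filter (ℕ × ℂ) := atTop ×ˢ 𝓟 (ball 0 (‖c‖⁻¹))
  have hfst : Tendsto (fun p : ℕ × ℂ => p.1) l atTop := tendsto_fst
  have hball : ∀ᶠ p in l, p.2 ∈ ball (0 : ℂ) (‖c‖⁻¹) :=
    (tendsto_snd (f := (atTop : Filter ℕ))).eventually (mem_principal_self _)
  have hbound : ∀ᶠ p in l, ‖s p.1 + p.2‖ ≤ S + ‖c‖⁻¹ := by
    filter_upwards [hball] with p hp
    refine (norm_add_le _ _).trans (add_le_add (hS _) ?_)
    exact (mem_ball_zero_iff.mp hp).le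
  let h : ℕ × ℂ → ℂ := fun p => (s p.1 + p.2) / p.1
  have hh : Tendsto h l (𝓝 0) := by
    have h1 : Tendsto (fun p : ℕ × ℂ => (S + ‖c‖⁻¹) / (p.1 : ℝ)) l (𝓝 0) :=
      (tendsto_const_div_atTop_nhds_zero_nat _).comp hfst
    refine squeeze_zero_norm' ?_ h1
    filter_upwards [hbound] with p hp
    simp only [h, norm_div, Complex.norm_natCast]
    gcongr
  have hE : Tendsto (fun p => E₀ + h p) l (𝓝 E₀) := by
    simpa using hh.const_add E₀
  have hpos : ∀ᶠ p in l, p.1 ≠ 0 := hfst.eventually (eventually_ne_atTop 0)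
  have hδ : Tendsto (fun p : ℕ × ℂ => p.1 * ℓ (h p) - c * (s p.1 + p.2)) l (𝓝 0) := by
    have h1 : (fun x => ℓ x - x * c) =o[𝓝 0] fun x => x := by
      have := hℓ.isLittleO
      simpa [hℓ0] using this
    have h2 := h1.comp_tendsto hh
    have h3 := (Asymptotics.isBigO_refl (fun p : ℕ × ℂ => (p.1 : ℂ)) l).mul_isLittleO h2
    have h4 : (fun p : ℕ × ℂ => (p.1 : ℂ) * h p) =O[l] fun _ => (1 : ℝ) := by
      refine Asymptotics.IsBigO.of_bound (S + ‖c‖⁻¹) ?_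
      filter_upwards [hbound, hpos] with p hp hp0
      have : (p.1 : ℂ) ≠ 0 := Nat.cast_ne_zero.mpr hp0
      simp only [h]
      rw [mul_div_cancel₀ _ this]
      simpa using hp
    have h5 := (Asymptotics.isLittleO_one_iff ℝ).mp (h3.trans_isBigO h4)
    refine h5.congr' ?_
    filter_upwards [hpos] with p hp0
    have : (p.1 : ℂ) ≠ 0 := Nat.cast_ne_zero.mpr hp0
    simp only [Function.comp, h]
    field_simp
  have hlim : Tendsto (fun p : ℕ × ℂ =>
      F p.1 (E₀ + h p) - a E₀ * (1 - Complex.exp (c * p.2))) l (𝓝 0) := by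
    have h1 : Tendsto (fun p => F p.1 (E₀ + h p) -
        (a (E₀ + h p) + w (E₀ + h p) ^ p.1 * b (E₀ + h p))) l (𝓝 0) :=
      hrem.comp (hfst.prodMk hE)
    have h2 : Tendsto (fun p => a (E₀ + h p) - a E₀) l (𝓝 0) := by
      simpa using (ha.tendsto.comp hE).sub_const (a E₀)
    have h3 : Tendsto (fun p : ℕ × ℂ => Complex.exp (p.1 * ℓ (h p) - c * (s p.1 + p.2)) *
        b (E₀ + h p) - b E₀) l (𝓝 0) := by
      have := (((Complex.continuous_exp.tendsto 0).comp hδ).mul (hb.tendsto.comp hE)).sub_const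
        (b E₀)
      simpa using this
    have h4 : (fun p : ℕ × ℂ => -(a E₀) / b E₀ * Complex.exp (c * p.2)) =O[l]
        fun _ => (1 : ℝ) := by
      refine Asymptotics.IsBigO.of_bound (‖-(a E₀) / b E₀‖ * Real.exp 1) ?_
      filter_upwards [hball] with p hp
      rw [norm_mul, norm_one, mul_one]
      gcongr
      rw [Complex.norm_exp]
      gcongr
      refine (Complex.re_le_norm _).trans ?_
      rw [norm_mul]
      calc ‖c‖ * ‖p.2‖ ≤ ‖c‖ * ‖c‖⁻¹ := by
            gcongr
            exact (mem_ball_zero_iff.mp hp).le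
        _ = 1 := mul_inv_cancel₀ (norm_ne_zero_iff.mpr hc)
    have h5 := (Asymptotics.isLittleO_one_iff ℝ).mp
      ((h4.mul_isLittleO ((Asymptotics.isLittleO_one_iff ℝ).mpr h3)).congr_right
        (g₂ := fun _ => (1 : ℝ)) (by simp))
    have h6 := (h1.add h2).add h5
    rw [add_zero, add_zero] at h6
    refine h6.congr' ?_
    filter_upwards [hh.eventually hexp] with p hp
    have hexp' : w (E₀ + h p) ^ p.1 = w E₀ ^ p.1 * Complex.exp (c * s p.1) *
        Complex.exp (c * p.2) * Complex.exp (p.1 * ℓ (h p) - c * (s p.1 + p.2)) := by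
      rw [hp, mul_pow, ← Complex.exp_nat_mul, mul_assoc, mul_assoc, ← Complex.exp_add,
        ← Complex.exp_add]
      congr 2
      ring
    rw [hs] at hexp'
    rw [hexp']
    field_simp
    ring
  have hclose : ∀ᶠ N in (atTop : Filter ℕ), ∀ t ∈ ball (0 : ℂ) (‖c‖⁻¹),
      ‖F N (E₀ + h (N, t)) - a E₀ * (1 - Complex.exp (c * t))‖ ≤ ‖a E₀‖ / 32 ∧
        ∀ M, DifferentiableAt ℂ (F M) (E₀ + h (N, t)) := by
    have h1 : ∀ᶠ p in l, ‖F p.1 (E₀ + h p) - a E₀ * (1 - Complex.exp (c * p.2))‖ ≤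
        ‖a E₀‖ / 32 := by
      have hpos : 0 < ‖a E₀‖ / 32 := by
        have := norm_pos_iff.mpr ha0
        positivity
      have := hlim.norm.eventually_le_const (u := ‖a E₀‖ / 32) (by simpa using hpos)
      exact this
    have h2 := hE.eventually hF
    filter_upwards [eventually_prod_principal_iff.mp (h1.and h2)] with N hN t ht
    exact hN t ht
  obtain ⟨N₁, hN₁⟩ := eventually_atTop.mp hclose
  refine ⟨S + ‖c‖⁻¹, by positivity, N₁, fun N hN => ?_⟩
  obtain ⟨t, ht, hzero⟩ := exists_zero_of_close_to_exp (G := fun t => F N (E₀ + h (N, t))) ha0 hc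
    (fun t ht => by
      have hdiff : DifferentiableAt ℂ (fun t => E₀ + h (N, t)) t := by
        simp only [h]
        fun_prop
      exact (((hN₁ N hN t ht).2 N).comp t hdiff).differentiableWithinAt)
    (fun t ht => (hN₁ N hN t ht).1)
  refine ⟨h (N, t), ?_, hzero⟩
  simp only [h, norm_div, Complex.norm_natCast]
  gcongr
  refine (norm_add_le _ _).trans (add_le_add (hS _) ?_)
  exact (mem_closedBall_zero_iff.mp ht).trans (half_le_self hcpos.le)

end BlockToeplitz

/-! ### Polynomials in the roots of a polynomial family -/

namespace BlockToeplitz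

open Polynomial

section SymmetricFamilies

variable {σ : Type*}

/-- Evaluation of a polynomial `G(E, x)` at an energy `E` and a point `x`, where `G` is encoded as a
polynomial in the variables `x` whose coefficients are polynomials in `E`. -/
noncomputable def evalAt (E : ℂ) (x : σ → ℂ) : MvPolynomial σ ℂ[X] →+* ℂ :=
  MvPolynomial.eval₂Hom (evalRingHom E) x

theorem continuousAt_evalAt {E₀ : ℂ} {ζ : σ → ℂ → ℂ} (hζ : ∀ i, ContinuousAt (ζ i) E₀)
    (G : MvPolynomial σ ℂ[X]) : ContinuousAt (fun E => evalAt E (fun i => ζ i E) G) E₀ := by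
  induction G using MvPolynomial.induction_on with
  | C q => simpa [evalAt] using q.continuous.continuousAt
  | add p q hp hq =>
    simp only [map_add]
    exact hp.add hq
  | mul_X p i hp =>
    have hX : ∀ E, evalAt E (fun i => ζ i E) (MvPolynomial.X i) = ζ i E := fun E => by
      simp [evalAt]
    simp only [map_mul, hX]
    exact hp.mul (hζ i)

variable [Fintype σ]

/-- A symmetric polynomial in the roots of a polynomial that depends polynomially on `E` depends
polynomially on `E`. -/
theorem exists_evalAt_eq_eval_of_isSymmetric (p : ℂ[X][X]) {H : MvPolynomial σ ℂ[X]}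
    (hH : H.IsSymmetric) :
    ∃ h : ℂ[X], ∀ (E : ℂ) (x : σ → ℂ), p.map (evalRingHom E) = ∏ i, (X - C (x i)) →
      evalAt E x H = h.eval E := by
  obtain ⟨Q, hQ⟩ := MvPolynomial.esymmAlgHom_surjective (σ := σ) ℂ[X] le_rfl ⟨H, hH⟩
  have hQ' : MvPolynomial.aeval (fun i : Fin (Fintype.card σ) =>
      MvPolynomial.esymm σ ℂ[X] (i + 1)) Q = H := by
    rw [← MvPolynomial.esymmAlgHom_apply, hQ]
  let g : Fin (Fintype.card σ) → ℂ[X] := fun i =>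
    (-1) ^ ((i : ℕ) + 1) * p.coeff (Fintype.card σ - (i + 1))
  refine ⟨MvPolynomial.aeval g Q, fun E x hx => ?_⟩
  have key : ∀ i : Fin (Fintype.card σ),
      evalAt E x (MvPolynomial.esymm σ ℂ[X] (i + 1)) = evalRingHom E (g i) := by
    intro i
    have h1 : evalAt E x (MvPolynomial.esymm σ ℂ[X] (i + 1)) =
        (Finset.univ.val.map x).esymm (i + 1) := by
      rw [← MvPolynomial.aeval_esymm_eq_multiset_esymm σ ℂ, MvPolynomial.aeval_def,
        ← MvPolynomial.map_esymm σ ℂ[X] (i + 1) (evalRingHom E), MvPolynomial.eval₂_map]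
      rfl
    have h2 : evalRingHom E (p.coeff (Fintype.card σ - (i + 1))) =
        (-1) ^ ((i : ℕ) + 1) * (Finset.univ.val.map x).esymm (i + 1) := by
      have hc : Multiset.card (Finset.univ.val.map x) = Fintype.card σ := by simp
      have h3 := Multiset.prod_X_sub_C_coeff (Finset.univ.val.map x)
        (k := Fintype.card σ - (i + 1)) (by rw [hc]; omega)
      have h4 : Fintype.card σ - (Fintype.card σ - ((i : ℕ) + 1)) = i + 1 := by
        have := i.isLt
        omega
      rw [hc, h4, Multiset.map_map] at h3
      rw [← h3, ← coeff_map, hx]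
      rfl
    rw [h1, map_mul, h2, ← mul_assoc, map_pow, map_neg, map_one, ← mul_pow]
    simp
  have hcomp : (evalAt E x).comp (algebraMap ℂ[X] (MvPolynomial σ ℂ[X])) =
      (evalRingHom E).comp (algebraMap ℂ[X] ℂ[X]) := by
    refine RingHom.ext fun q => ?_
    simp [evalAt, MvPolynomial.algebraMap_eq]
  rw [← hQ', ← coe_evalRingHom, MvPolynomial.map_aeval, MvPolynomial.map_aeval, hcomp]
  simp only [key]

/-- The number of orderings of the roots of a polynomial family at which a given polynomial in the
roots vanishes is the same for all but finitely many values of the parameter. -/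
theorem exists_card_zeros_eq [DecidableEq σ] (p : ℂ[X][X]) (G : MvPolynomial σ ℂ[X]) :
    ∃ (B : Set ℂ) (m : ℕ), B.Finite ∧ ∀ E ∉ B, ∀ x : σ → ℂ,
      p.map (evalRingHom E) = ∏ i, (X - C (x i)) →
        (Finset.univ.filter fun τ : Equiv.Perm σ => evalAt E (x ∘ τ) G = 0).card = m := by
  -- The number in question is the order of vanishing at `0` of this polynomial.
  let P : (MvPolynomial σ ℂ[X])[X] := ∏ τ : Equiv.Perm σ, (X - C (MvPolynomial.rename τ G))
  have hsymm : ∀ k, (P.coeff k).IsSymmetric := by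
    intro k τ
    have h1 : P.map (MvPolynomial.rename τ : MvPolynomial σ ℂ[X] →ₐ[ℂ[X]] _).toRingHom = P := by
      simp only [P, Polynomial.map_prod, Polynomial.map_sub, map_X, map_C]
      refine Fintype.prod_equiv (Equiv.mulLeft τ) _ _ fun τ' => ?_
      simp [MvPolynomial.rename_rename, Equiv.Perm.coe_mul]
    conv_rhs => rw [← h1]
    rw [coeff_map]
    rfl
  choose h hh using fun k => exists_evalAt_eq_eval_of_isSymmetric p (hsymm k)
  have hcoeff : ∀ (E : ℂ) (x : σ → ℂ), p.map (evalRingHom E) = ∏ i, (X - C (x i)) → ∀ k,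
      (∏ τ : Equiv.Perm σ, (X - C (evalAt E (x ∘ τ) G))).coeff k = (h k).eval E := by
    intro E x hx k
    rw [← hh k E x hx, ← coeff_map]
    congr 1
    simp only [P, Polynomial.map_prod, Polynomial.map_sub, map_X, map_C]
    refine Finset.prod_congr rfl fun τ _ => ?_
    simp [evalAt, MvPolynomial.eval₂_rename]
  have hmonic : ∀ (E : ℂ) (x : σ → ℂ),
      (∏ τ : Equiv.Perm σ, (X - C (evalAt E (x ∘ τ) G))).Monic := fun E x =>
    monic_prod_of_monic _ _ fun τ _ => monic_X_sub_C _
  by_cases hex : ∃ k, h k ≠ 0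
  · classical
    refine ⟨{E | (h (Nat.find hex)).IsRoot E}, Nat.find hex,
      finite_setOfPred_isRoot (Nat.find_spec hex), fun E hE x hx => ?_⟩
    have htrail : (∏ τ : Equiv.Perm σ, (X - C (evalAt E (x ∘ τ) G))).natTrailingDegree =
        Nat.find hex := by
      apply le_antisymm
      · apply natTrailingDegree_le_of_ne_zero
        rw [hcoeff E x hx]
        exact hE
      · refine le_natTrailingDegree (hmonic E x).ne_zero fun k hk => ?_
        rw [hcoeff E x hx, not_not.mp (Nat.find_min hex hk), eval_zero]
    rw [← htrail, ← rootMultiplicity_eq_natTrailingDegree', ← count_roots, roots_prod,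
      Multiset.count_bind]
    · rw [Finset.card_filter]
      refine Finset.sum_congr rfl fun τ _ => ?_
      simp [Multiset.count_singleton, eq_comm]
    · exact (hmonic E x).ne_zero
  · refine ⟨∅, 0, Set.finite_empty, fun E _ x hx => ?_⟩
    push Not at hex
    refine absurd ?_ (hmonic E x).ne_zero
    ext k
    rw [hcoeff E x hx, hex, eval_zero, coeff_zero]

/-- Outside a finite set of energies, a polynomial in `E` and the roots that vanishes at a point
vanishes near that point along the continuation of the roots: since the total number of vanishing
orderings is locally constant, none of them can cease to vanish. -/
theorem exists_finite_forall_eventually_evalAt_eq_zero (p : ℂ[X][X]) (G : MvPolynomial σ ℂ[X]) :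
    ∃ B : Set ℂ, B.Finite ∧ ∀ E₀ ∉ B, ∀ ζ : σ → ℂ → ℂ, (∀ i, ContinuousAt (ζ i) E₀) →
      (∀ᶠ E in 𝓝 E₀, p.map (evalRingHom E) = ∏ i, (X - C (ζ i E))) →
        evalAt E₀ (fun i => ζ i E₀) G = 0 → ∀ᶠ E in 𝓝 E₀, evalAt E (fun i => ζ i E) G = 0 := by
  classical
  obtain ⟨B, m, hB, hm⟩ := exists_card_zeros_eq p G
  refine ⟨B, hB, fun E₀ hE₀ ζ hζ hp h0 => ?_⟩
  have hne : ∀ᶠ E in 𝓝 E₀, ∀ τ : Equiv.Perm σ, evalAt E₀ (fun i => ζ (τ i) E₀) G ≠ 0 →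
      evalAt E (fun i => ζ (τ i) E) G ≠ 0 := by
    rw [Filter.eventually_all]
    intro τ
    by_cases h : evalAt E₀ (fun i => ζ (τ i) E₀) G = 0
    · simp [h]
    · filter_upwards [(continuousAt_evalAt (fun i => hζ (τ i)) G).eventually_ne h] with E hE _
      exact hE
  have hcard₀ := hm E₀ hE₀ (fun i => ζ i E₀) hp.self_of_nhds
  filter_upwards [hne, hp, hB.isClosed.isOpen_compl.mem_nhds hE₀] with E hE hpE hEB
  have hcard := hm E hEB (fun i => ζ i E) hpE
  have hsub : (Finset.univ.filter fun τ : Equiv.Perm σ =>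
      evalAt E ((fun i => ζ i E) ∘ τ) G = 0) ⊆ Finset.univ.filter fun τ : Equiv.Perm σ =>
      evalAt E₀ ((fun i => ζ i E₀) ∘ τ) G = 0 := by
    intro τ hτ
    rw [Finset.mem_filter] at hτ ⊢
    exact ⟨hτ.1, by_contra fun h => hE τ h hτ.2⟩
  have heq := Finset.eq_of_subset_of_card_le hsub (by rw [hcard, hcard₀])
  have hmem : (1 : Equiv.Perm σ) ∈ Finset.univ.filter fun τ : Equiv.Perm σ =>
      evalAt E ((fun i => ζ i E) ∘ τ) G = 0 := by
    rw [heq, Finset.mem_filter]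
    exact ⟨Finset.mem_univ _, h0⟩
  exact (Finset.mem_filter.mp hmem).2

end SymmetricFamilies

end BlockToeplitz

/-! ### Roots of polynomial families and the transfer matrix as a polynomial family -/

namespace BlockToeplitz

open Polynomial

section RootsOfFamilies

theorem contDiff_eval_map_evalRingHom (p : ℂ[X][X]) :
    ContDiff ℂ ⊤ fun u : ℂ × ℂ => (p.map (evalRingHom u.1)).eval u.2 := by
  induction p using Polynomial.induction_on' with
  | add p q hp hq =>
    simp only [Polynomial.map_add, eval_add]
    exact hp.add hq
  | monomial n q =>
    simp only [map_monomial, eval_monomial, coe_evalRingHom]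
    have hq : ContDiff ℂ ⊤ fun u : ℂ × ℂ => q.eval u.1 := by
      have : ContDiff ℂ ⊤ fun z : ℂ => q.eval z := by
        simpa using q.contDiff_aeval (𝕜 := ℂ) ⊤
      exact this.comp contDiff_fst
    exact hq.mul (contDiff_snd.pow n)

/-- A simple root of a polynomial family continues analytically in the parameter. -/
theorem exists_analyticAt_root (p : ℂ[X][X]) {E₀ y₀ : ℂ}
    (h0 : (p.map (evalRingHom E₀)).eval y₀ = 0)
    (h1 : (p.map (evalRingHom E₀)).derivative.eval y₀ ≠ 0) :
    ∃ ζ : ℂ → ℂ, ζ E₀ = y₀ ∧ AnalyticAt ℂ ζ E₀ ∧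
      ∀ᶠ E in 𝓝 E₀, (p.map (evalRingHom E)).eval (ζ E) = 0 := by
  have hf := (contDiff_eval_map_evalRingHom p).contDiffAt (x := (E₀, y₀))
  set f : ℂ × ℂ → ℂ := fun u => (p.map (evalRingHom u.1)).eval u.2 with hf_def
  have hder : (fderiv ℂ f (E₀, y₀) ∘L .inr ℂ ℂ ℂ) 1 =
      (p.map (evalRingHom E₀)).derivative.eval y₀ := by
    have h := (hf.differentiableAt (by simp)).hasFDerivAt.comp_hasDerivAt y₀
      ((hasDerivAt_const y₀ E₀).prodMk (hasDerivAt_id y₀))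
    exact h.unique ((p.map (evalRingHom E₀)).hasDerivAt y₀)
  have hinv : (fderiv ℂ f (E₀, y₀) ∘L .inr ℂ ℂ ℂ).IsInvertible := by
    refine ⟨ContinuousLinearEquiv.unitsEquivAut ℂ (Units.mk0 _ h1), ?_⟩
    ext
    simpa using hder.symm
  refine ⟨hf.implicitFunction (by simp) hinv, hf.implicitFunction_apply_self (by simp) hinv, ?_, ?_⟩
  · exact (hf.contDiffAt_implicitFunction (by simp) hinv).analyticAt
  · filter_upwards [hf.eventually_apply_implicitFunction (by simp) hinv] with E hE
    rw [← h0]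
    exact hE

/-- The chain rule for a polynomial family `p` along a curve `ζ`; the family `q` is the derivative of
`p` with respect to the parameter. -/
theorem exists_hasDerivAt_eval_map_evalRingHom (p : ℂ[X][X]) :
    ∃ q : ℂ[X][X], ∀ (ζ : ℂ → ℂ) (E ζ' : ℂ), HasDerivAt ζ ζ' E →
      HasDerivAt (fun E => (p.map (evalRingHom E)).eval (ζ E))
        ((q.map (evalRingHom E)).eval (ζ E) +
          (p.derivative.map (evalRingHom E)).eval (ζ E) * ζ') E := by
  induction p using Polynomial.induction_on' with
  | add p₁ p₂ h₁ h₂ =>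
    obtain ⟨q₁, hq₁⟩ := h₁
    obtain ⟨q₂, hq₂⟩ := h₂
    refine ⟨q₁ + q₂, fun ζ E ζ' hζ => ?_⟩
    simp only [Polynomial.map_add, eval_add, derivative_add]
    exact ((hq₁ ζ E ζ' hζ).add (hq₂ ζ E ζ' hζ)).congr_deriv (by ring)
  | monomial n r =>
    refine ⟨monomial n r.derivative, fun ζ E ζ' hζ => ?_⟩
    simp only [map_monomial, eval_monomial, coe_evalRingHom, derivative_monomial]
    exact ((r.hasDerivAt E).mul (hζ.pow n)).congr_deriv (by simp; ring)

/-- The derivative of the quotient `ζ₁ / ζ₂` of two simple roots of a polynomial family vanishes if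
and only if a certain polynomial in the parameter and the two roots does. -/
theorem exists_evalAt_eq_zero_iff_deriv_div_eq_zero {σ : Type*} (p : ℂ[X][X]) (i j : σ) :
    ∃ G : MvPolynomial σ ℂ[X], ∀ (E : ℂ) (ζ : σ → ℂ → ℂ),
      (∀ k, DifferentiableAt ℂ (ζ k) E) →
      (∀ k, ∀ᶠ E' in 𝓝 E, (p.map (evalRingHom E')).eval (ζ k E') = 0) →
      (∀ k, (p.map (evalRingHom E)).derivative.eval (ζ k E) ≠ 0) → ζ j E ≠ 0 →
      (evalAt E (fun k => ζ k E) G = 0 ↔ deriv (fun E' => ζ i E' / ζ j E') E = 0) := by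
  obtain ⟨q, hq⟩ := exists_hasDerivAt_eval_map_evalRingHom p
  let ev : ℂ[X][X] → σ → MvPolynomial σ ℂ[X] := fun r k => r.eval₂ MvPolynomial.C (MvPolynomial.X k)
  have hev : ∀ r k E (x : σ → ℂ), evalAt E x (ev r k) = (r.map (evalRingHom E)).eval (x k) := by
    intro r k E x
    simp only [ev, hom_eval₂, eval_map]
    congr 1
    · refine RingHom.ext fun c => ?_
      simp [evalAt]
    · simp [evalAt]
  refine ⟨ev q j * ev p.derivative i * MvPolynomial.X i -
    ev q i * ev p.derivative j * MvPolynomial.X j, fun E ζ hζ hroot hsimple hj => ?_⟩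
  have himp : ∀ k, (q.map (evalRingHom E)).eval (ζ k E) =
      -((p.derivative.map (evalRingHom E)).eval (ζ k E) * deriv (ζ k) E) := by
    intro k
    have h1 := hq (ζ k) E _ (hζ k).hasDerivAt
    have h2 : HasDerivAt (fun E' => (p.map (evalRingHom E')).eval (ζ k E')) 0 E :=
      (hasDerivAt_const E (0 : ℂ)).congr_of_eventuallyEq (hroot k)
    exact eq_neg_of_add_eq_zero_left (h1.unique h2)
  have hX : ∀ k, evalAt E (fun k => ζ k E) (MvPolynomial.X k) = ζ k E := fun k => by simp [evalAt]
  rw [deriv_fun_div (hζ i) (hζ j) hj, map_sub, map_mul, map_mul, map_mul, map_mul, hX, hX,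
    hev, hev, hev, hev, himp, himp, div_eq_zero_iff, or_iff_left (pow_ne_zero 2 hj)]
  simp only [derivative_map] at hsimple
  have hmul := mul_ne_zero (hsimple i) (hsimple j)
  rw [← mul_eq_zero_iff_left hmul (b := deriv (ζ i) E * ζ j E - ζ i E * deriv (ζ j) E)]
  refine Eq.congr ?_ rfl
  ring

end RootsOfFamilies

section TransferPolynomials

open Matrix

variable {L : ℕ}

/-- The transfer matrix as a matrix of polynomials in the energy. -/
noncomputable def transferPoly (R V T : Matrix (Fin L) (Fin L) ℂ) :
    Matrix (Fin L ⊕ Fin L) (Fin L ⊕ Fin L) ℂ[X] :=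
  fromBlocks (((X : ℂ[X]) • (1 : Matrix (Fin L) (Fin L) ℂ[X]) - RingHom.mapMatrix C V) *
    RingHom.mapMatrix C T⁻¹) (-(RingHom.mapMatrix C R)) (RingHom.mapMatrix C T⁻¹) 0

theorem transferPoly_map_evalRingHom (R V T : Matrix (Fin L) (Fin L) ℂ) (E : ℂ) :
    (evalRingHom E).mapMatrix (transferPoly R V T) = transferMatrix R V T E := by
  have hC : ∀ A : Matrix (Fin L) (Fin L) ℂ, (evalRingHom E).mapMatrix (RingHom.mapMatrix C A) = A := by
    intro A
    ext i j
    simp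
  have hX : (evalRingHom E).mapMatrix ((X : ℂ[X]) • (1 : Matrix (Fin L) (Fin L) ℂ[X])) =
      E • (1 : Matrix (Fin L) (Fin L) ℂ) := by
    ext i j
    by_cases h : i = j <;> simp [h]
  have h11 : (evalRingHom E).mapMatrix
      (((X : ℂ[X]) • (1 : Matrix (Fin L) (Fin L) ℂ[X]) - RingHom.mapMatrix C V) *
        RingHom.mapMatrix C T⁻¹) =
      (E • (1 : Matrix (Fin L) (Fin L) ℂ) - V) * T⁻¹ := by
    rw [map_mul, map_sub, hX, hC, hC]
  rw [transferPoly, transferMatrix, RingHom.mapMatrix_apply, fromBlocks_map]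
  rw [← h11]
  congr 1
  · ext i j
    simp
  · exact hC _
  · ext i j
    simp

theorem charpoly_transferPoly_map (R V T : Matrix (Fin L) (Fin L) ℂ) (E : ℂ) :
    (transferPoly R V T).charpoly.map (evalRingHom E) = (transferMatrix R V T E).charpoly := by
  rw [← charpoly_map, ← RingHom.mapMatrix_apply, transferPoly_map_evalRingHom]

theorem differentiable_det_toBlocks₂₁_pow (R V T : Matrix (Fin L) (Fin L) ℂ) (N : ℕ) :
    Differentiable ℂ fun E => ((transferMatrix R V T E) ^ N).toBlocks₂₁.det := by
  have h : ∀ E, ((transferMatrix R V T E) ^ N).toBlocks₂₁.det =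
      ((transferPoly R V T) ^ N).toBlocks₂₁.det.eval E := by
    intro E
    rw [← transferPoly_map_evalRingHom, ← map_pow, ← coe_evalRingHom, RingHom.map_det]
    rfl
  simp only [h]
  exact Polynomial.differentiable _

/-- The polynomial in the energy and the eigenvalues that gives the determinant of the lower left
block of `∏ j ∈ Sᶜ, (𝒯 - x j)`. -/
noncomputable def blockPoly (R V T : Matrix (Fin L) (Fin L) ℂ) (S : Finset (Fin L ⊕ Fin L)) :
    MvPolynomial (Fin L ⊕ Fin L) ℂ[X] :=
  (aeval (RingHom.mapMatrix (MvPolynomial.C : ℂ[X] →+* MvPolynomial (Fin L ⊕ Fin L) ℂ[X])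
    (transferPoly R V T)) (∏ j ∈ Sᶜ, (X - C (MvPolynomial.X j : MvPolynomial (Fin L ⊕ Fin L)
      ℂ[X])))).toBlocks₂₁.det

theorem evalAt_blockPoly (R V T : Matrix (Fin L) (Fin L) ℂ) (S : Finset (Fin L ⊕ Fin L)) (E : ℂ)
    (x : Fin L ⊕ Fin L → ℂ) :
    evalAt E x (blockPoly R V T S) =
      (aeval (transferMatrix R V T E) (∏ j ∈ Sᶜ, (X - C (x j)))).toBlocks₂₁.det := by
  have h1 : (algebraMap ℂ (Matrix (Fin L ⊕ Fin L) (Fin L ⊕ Fin L) ℂ)).comp (evalAt E x) =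
      (evalAt E x).mapMatrix.comp (algebraMap (MvPolynomial (Fin L ⊕ Fin L) ℂ[X])
        (Matrix (Fin L ⊕ Fin L) (Fin L ⊕ Fin L) (MvPolynomial (Fin L ⊕ Fin L) ℂ[X]))) := by
    refine RingHom.ext fun q => ?_
    ext i j
    by_cases h : i = j <;> simp [Matrix.algebraMap_matrix_apply, h]
  have h2 : (evalAt E x).mapMatrix (RingHom.mapMatrix MvPolynomial.C (transferPoly R V T)) =
      transferMatrix R V T E := by
    rw [← transferPoly_map_evalRingHom]
    ext i j
    simp [evalAt]
  have h3 : (∏ j ∈ Sᶜ, (X - C (MvPolynomial.X j : MvPolynomial (Fin L ⊕ Fin L) ℂ[X]))).map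
      (evalAt E x) = ∏ j ∈ Sᶜ, (X - C (x j)) := by
    simp [Polynomial.map_prod, evalAt]
  rw [← h3, ← h2, ← map_aeval_eq_aeval_map h1, blockPoly, RingHom.map_det]
  rfl

end TransferPolynomials

end BlockToeplitz

/-! ### Labelling and ordering of the eigenvalues -/

namespace BlockToeplitz

open Polynomial Filter

variable {L : ℕ}

section Labels

/-- The index `1, …, 2 * L` of an eigenvalue that corresponds to a label in `Fin L ⊕ Fin L`: the
left summand labels the first `L` eigenvalues and the right summand the last `L` ones. -/
def eigIndex : Fin L ⊕ Fin L → ℕ :=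
  Sum.elim (fun i => i + 1) (fun i => L + i + 1)

theorem eigIndex_injective : Function.Injective (eigIndex (L := L)) := by
  rintro (i | i) (j | j) h <;> simp only [eigIndex, Sum.elim_inl, Sum.elim_inr] at h
  · exact congrArg _ (Fin.ext (by omega))
  · have := i.isLt
    omega
  · have := j.isLt
    omega
  · exact congrArg _ (Fin.ext (by omega))

theorem eigIndex_mem_Icc (i : Fin L ⊕ Fin L) : eigIndex i ∈ Finset.Icc 1 (2 * L) := by
  rw [Finset.mem_Icc]
  rcases i with i | i <;> have := i.isLt <;> simp only [eigIndex, Sum.elim_inl, Sum.elim_inr] <;>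
    omega

theorem image_eigIndex_univ :
    Finset.univ.image (eigIndex (L := L)) = Finset.Icc 1 (2 * L) := by
  refine Finset.eq_of_subset_of_card_le ?_ ?_
  · intro l hl
    obtain ⟨i, _, rfl⟩ := Finset.mem_image.mp hl
    exact eigIndex_mem_Icc i
  · rw [Finset.card_image_of_injective _ eigIndex_injective, Finset.card_univ]
    simp
    omega

theorem Icc_val_map_eq_univ_val_map (z : ℕ → ℂ) :
    (Finset.Icc 1 (2 * L)).val.map z =
      (Finset.univ : Finset (Fin L ⊕ Fin L)).val.map fun i => z (eigIndex i) := by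
  rw [← image_eigIndex_univ, Finset.image_val_of_injOn eigIndex_injective.injOn, Multiset.map_map]
  rfl

/-- The label of the eigenvalue `z L`. -/
def lowerMiddle (hL : 1 ≤ L) : Fin L ⊕ Fin L := Sum.inl ⟨L - 1, by omega⟩

/-- The label of the eigenvalue `z (L + 1)`. -/
def upperMiddle (hL : 1 ≤ L) : Fin L ⊕ Fin L := Sum.inr ⟨0, by omega⟩

theorem eigIndex_lowerMiddle (hL : 1 ≤ L) : eigIndex (lowerMiddle hL) = L := by
  simp only [eigIndex, lowerMiddle, Sum.elim_inl]
  omega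

theorem eigIndex_upperMiddle (hL : 1 ≤ L) : eigIndex (upperMiddle hL) = L + 1 := by
  simp [eigIndex, upperMiddle]

/-- The labels of the first `L` eigenvalues. -/
def lowerLabels (L : ℕ) : Finset (Fin L ⊕ Fin L) := Finset.univ.filter fun i => i.isLeft

theorem mem_lowerLabels (i : Fin L ⊕ Fin L) : i ∈ lowerLabels L ↔ eigIndex i ≤ L := by
  rcases i with i | i <;> have := i.isLt <;> simp [lowerLabels, eigIndex]

theorem lowerMiddle_mem (hL : 1 ≤ L) : lowerMiddle hL ∈ lowerLabels L := by
  simp [lowerLabels, lowerMiddle]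

theorem upperMiddle_notMem (hL : 1 ≤ L) : upperMiddle hL ∉ lowerLabels L := by
  simp [lowerLabels, upperMiddle]

/-- The labels of the first `L` eigenvalues with `z L` exchanged for `z (L + 1)`. -/
def exchangedLabels (hL : 1 ≤ L) : Finset (Fin L ⊕ Fin L) :=
  insert (upperMiddle hL) ((lowerLabels L).erase (lowerMiddle hL))

theorem image_eigIndex_lowerLabels : (lowerLabels L).image eigIndex = indexSet0 L := by
  ext l
  simp only [Finset.mem_image, mem_lowerLabels, indexSet0, Finset.mem_Icc]
  constructor
  · rintro ⟨i, hi, rfl⟩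
    exact ⟨(Finset.mem_Icc.mp (eigIndex_mem_Icc i)).1, hi⟩
  · rintro ⟨h1, h2⟩
    exact ⟨Sum.inl ⟨l - 1, by omega⟩, by simp [eigIndex]; omega, by simp [eigIndex]; omega⟩

theorem card_lowerLabels : (lowerLabels L).card = L := by
  rw [← Finset.card_image_of_injective _ eigIndex_injective, image_eigIndex_lowerLabels]
  simp [indexSet0]

theorem card_compl_lowerLabels : (lowerLabels L)ᶜ.card = L := by
  rw [Finset.card_compl, card_lowerLabels]
  simp

theorem image_eigIndex_exchangedLabels (hL : 1 ≤ L) :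
    (exchangedLabels hL).image eigIndex = indexSet1 L := by
  rw [exchangedLabels, Finset.image_insert, eigIndex_upperMiddle,
    Finset.image_erase eigIndex_injective, eigIndex_lowerMiddle, image_eigIndex_lowerLabels,
    indexSet1, indexSet0]
  congr 1
  ext l
  simp only [Finset.mem_erase, Finset.mem_Icc]
  omega

theorem card_exchangedLabels (hL : 1 ≤ L) : (exchangedLabels hL).card = L := by
  rw [exchangedLabels, Finset.card_insert_of_notMem
    (fun h => upperMiddle_notMem hL (Finset.mem_of_mem_erase h)),
    Finset.card_erase_of_mem (lowerMiddle_mem hL), card_lowerLabels]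
  omega

theorem compl_exchangedLabels (hL : 1 ≤ L) :
    (exchangedLabels hL)ᶜ =
      insert (lowerMiddle hL) ((lowerLabels L)ᶜ.erase (upperMiddle hL)) := by
  have h1 := lowerMiddle_mem hL
  have h2 := upperMiddle_notMem hL
  ext i
  simp only [exchangedLabels, Finset.mem_compl, Finset.mem_insert, Finset.mem_erase]
  by_cases hi : i = lowerMiddle hL
  · subst hi
    have : lowerMiddle hL ≠ upperMiddle hL := fun h => h2 (h ▸ h1)
    simp [this]
  · simp [hi]

end Labels

section Ordering

/-- Among the sets of `card J` factors, the largest product is attained only at `J` and at `J` with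
`b` exchanged for `a`, if `J` collects the factors above `ρ` and `a`, `b` are the only ones that may
equal `ρ`. -/
theorem prod_lt_prod_of_dominant {σ : Type*} [DecidableEq σ] {f : σ → ℝ} {ρ : ℝ} {I J : Finset σ}
    {a b : σ} (hpos : ∀ i, 0 < f i) (hρ : 0 < ρ) (hbJ : b ∈ J)
    (hlow : ∀ i ∉ J, f i ≤ ρ) (hlow' : ∀ i ∉ J, i ≠ a → f i < ρ)
    (hup : ∀ i ∈ J, ρ ≤ f i) (hup' : ∀ i ∈ J, i ≠ b → ρ < f i)
    (hcard : I.card = J.card) (hIJ : I ≠ J) (hIJ' : I ≠ insert a (J.erase b)) :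
    ∏ i ∈ I, f i < ∏ i ∈ J, f i := by
  rw [← Finset.prod_inter_mul_prod_sdiff I J, ← Finset.prod_inter_mul_prod_sdiff J I,
    Finset.inter_comm J I]
  have hc : (I \ J).card = (J \ I).card := Finset.card_sdiff_comm hcard
  have hne : (I \ J).Nonempty := by
    rw [Finset.sdiff_nonempty]
    exact fun h => hIJ (Finset.eq_of_subset_of_card_le h hcard.ge)
  have hne' : (J \ I).Nonempty := by
    rw [← Finset.card_pos, ← hc]
    exact hne.card_pos
  refine mul_lt_mul_of_pos_left ?_ (Finset.prod_pos fun i _ => hpos i)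
  have h1 : ∏ i ∈ I \ J, f i ≤ ρ ^ (I \ J).card := by
    rw [← Finset.prod_const]
    exact Finset.prod_le_prod (fun i _ => (hpos i).le)
      fun i hi => hlow i (Finset.mem_sdiff.mp hi).2
  have h2 : ρ ^ (J \ I).card ≤ ∏ i ∈ J \ I, f i := by
    rw [← Finset.prod_const]
    exact Finset.prod_le_prod (fun _ _ => hρ.le) fun i hi => hup i (Finset.mem_sdiff.mp hi).1
  rw [← hc] at h2
  by_cases hex : ∃ i ∈ I \ J, i ≠ a
  · obtain ⟨i, hi, hia⟩ := hex
    refine lt_of_lt_of_le ?_ h2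
    rw [← Finset.prod_const]
    exact Finset.prod_lt_prod (fun i _ => hpos i)
      (fun i hi => hlow i (Finset.mem_sdiff.mp hi).2)
      ⟨i, hi, hlow' i (Finset.mem_sdiff.mp hi).2 hia⟩
  · -- Then `I \ J = {a}`, and `J \ I` is a singleton different from `{b}`.
    push Not at hex
    have hIa : I \ J = {a} := Finset.eq_singleton_iff_nonempty_unique_mem.mpr ⟨hne, hex⟩
    obtain ⟨j, hj⟩ := Finset.card_eq_one.mp (hc.symm.trans (by rw [hIa, Finset.card_singleton]))
    have hjb : j ≠ b := by
      rintro rfl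
      apply hIJ'
      ext i
      have hi1 : i ∈ I \ J ↔ i = a := by rw [hIa, Finset.mem_singleton]
      have hi2 : i ∈ J \ I ↔ i = j := by rw [hj, Finset.mem_singleton]
      rw [Finset.mem_sdiff] at hi1 hi2
      rw [Finset.mem_insert, Finset.mem_erase]
      tauto
    have hjJ : j ∈ J := (Finset.mem_sdiff.mp (hj ▸ Finset.mem_singleton_self j)).1
    refine lt_of_le_of_lt h1 ?_
    rw [hIa, hj, Finset.card_singleton, Finset.prod_singleton, pow_one]
    exact hup' j hjJ hjb

theorem IsOrderedEigenvalues.norm_mono {M : Matrix (Fin L ⊕ Fin L) (Fin L ⊕ Fin L) ℂ} {z : ℕ → ℂ}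
    (hz : IsOrderedEigenvalues M z) {i j : ℕ} (hi : 1 ≤ i) (hij : i ≤ j) (hj : j ≤ 2 * L) :
    ‖z i‖ ≤ ‖z j‖ := by
  induction j, hij using Nat.le_induction with
  | base => exact le_rfl
  | succ k hik ih => exact (ih (by omega)).trans (hz.2 k (by omega) hj)

/-- If a labelling of the eigenvalues separates those of modulus at most `ρ` from those of modulus at
least `ρ`, and the modulus `ρ` is attained on both sides, then the two middle moduli of the ordered
list are equal: fewer than `L` eigenvalues lie strictly below `ρ`, and fewer than `L` strictly above. -/
theorem IsOrderedEigenvalues.norm_middle_eq (hL : 1 ≤ L)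
    {M : Matrix (Fin L ⊕ Fin L) (Fin L ⊕ Fin L) ℂ} {z : ℕ → ℂ}
    (hz : IsOrderedEigenvalues M z) {x : Fin L ⊕ Fin L → ℂ} {ρ : ℝ}
    (hx : M.charpoly = ∏ i, (X - C (x i)))
    (hlow : ∀ i ∈ lowerLabels L, ‖x i‖ ≤ ρ) (hup : ∀ i ∉ lowerLabels L, ρ ≤ ‖x i‖)
    (ha : ‖x (lowerMiddle hL)‖ = ρ) (hb : ‖x (upperMiddle hL)‖ = ρ) :
    ‖z L‖ = ‖z (L + 1)‖ := by
  have hroots : (Finset.Icc 1 (2 * L)).val.map z = Finset.univ.val.map x := by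
    rw [← hz.1, hx, roots_prod _ _ (Finset.prod_ne_zero_iff.mpr fun i _ => X_sub_C_ne_zero _)]
    simp [Multiset.bind_singleton]
  have hcount : ∀ P : ℂ → Prop, ∀ [DecidablePred P],
      ((Finset.Icc 1 (2 * L)).filter fun l => P (z l)).card =
        (Finset.univ.filter fun i => P (x i)).card := by
    intro P _
    have := congrArg (Multiset.countP P) hroots
    rw [Multiset.countP_map, Multiset.countP_map] at this
    exact this
  have h1 : ∀ l, L ≤ l → l ≤ 2 * L → ρ ≤ ‖z l‖ := by
    intro l hl hl'
    by_contra! hlt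
    have hsub : Finset.Icc 1 L ⊆ (Finset.Icc 1 (2 * L)).filter fun l => ‖z l‖ < ρ := by
      intro k hk
      rw [Finset.mem_Icc] at hk
      rw [Finset.mem_filter, Finset.mem_Icc]
      exact ⟨by omega, (hz.norm_mono hk.1 (by omega) hl').trans_lt hlt⟩
    have hsub' : (Finset.univ.filter fun i => ‖x i‖ < ρ) ⊆
        (lowerLabels L).erase (lowerMiddle hL) := by
      intro i hi
      have hi := (Finset.mem_filter.mp hi).2
      rw [Finset.mem_erase]
      refine ⟨?_, by_contra fun h => (hup i h).not_gt hi⟩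
      rintro rfl
      exact hi.ne ha
    have hc := (Finset.card_le_card hsub).trans_eq (hcount fun y => ‖y‖ < ρ)
    have hc' := Finset.card_le_card hsub'
    rw [Finset.card_erase_of_mem (lowerMiddle_mem hL), card_lowerLabels] at hc'
    rw [Nat.card_Icc] at hc
    omega
  have h2 : ∀ l, 1 ≤ l → l ≤ L + 1 → ‖z l‖ ≤ ρ := by
    intro l hl hl'
    by_contra! hlt
    have hsub : Finset.Icc (L + 1) (2 * L) ⊆
        (Finset.Icc 1 (2 * L)).filter fun l => ρ < ‖z l‖ := by
      intro k hk
      rw [Finset.mem_Icc] at hk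
      rw [Finset.mem_filter, Finset.mem_Icc]
      exact ⟨by omega, hlt.trans_le (hz.norm_mono hl (by omega) hk.2)⟩
    have hsub' : (Finset.univ.filter fun i => ρ < ‖x i‖) ⊆
        (lowerLabels L)ᶜ.erase (upperMiddle hL) := by
      intro i hi
      have hi := (Finset.mem_filter.mp hi).2
      rw [Finset.mem_erase, Finset.mem_compl]
      refine ⟨?_, fun h => (hlow i h).not_gt hi⟩
      rintro rfl
      exact hi.ne' hb
    have hc := (Finset.card_le_card hsub).trans_eq (hcount fun y => ρ < ‖y‖)
    have hc' := Finset.card_le_card hsub'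
    rw [Finset.card_erase_of_mem (Finset.mem_compl.mpr (upperMiddle_notMem hL)),
      card_compl_lowerLabels] at hc'
    rw [Nat.card_Icc] at hc
    omega
  rw [le_antisymm (h2 L hL (by omega)) (h1 L le_rfl (by omega)),
    le_antisymm (h2 (L + 1) (by omega) le_rfl) (h1 (L + 1) (by omega) (by omega))]

end Ordering

section Labelling

variable {R V T : Matrix (Fin L) (Fin L) ℂ}

theorem charpoly_eq_prod_of_injective {n : Type*} [Fintype n] [DecidableEq n] {M : Matrix n n ℂ}
    {x : n → ℂ} (hinj : Function.Injective x) (hx : ∀ i, x i ∈ spectrum ℂ M) :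
    M.charpoly = ∏ i, (X - C (x i)) := by
  have hle : Finset.univ.val.map x ≤ M.charpoly.roots := by
    rw [Multiset.le_iff_subset (Finset.univ.nodup.map hinj)]
    intro y hy
    obtain ⟨i, _, rfl⟩ := Multiset.mem_map.mp hy
    exact (mem_roots M.charpoly_monic.ne_zero).mpr
      (Matrix.mem_spectrum_iff_isRoot_charpoly.mp (hx i))
  have hroots : Finset.univ.val.map x = M.charpoly.roots := by
    refine Multiset.eq_of_le_of_card_le hle ((card_roots' _).trans ?_)
    rw [Matrix.charpoly_natDegree_eq_dim, Multiset.card_map]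
    rfl
  rw [(IsAlgClosed.splits M.charpoly).eq_prod_roots_of_monic M.charpoly_monic, ← hroots,
    Multiset.map_map]
  rfl

theorem IsOrderedEigenvalues.injective_of_notMem_degenerateSet {E : ℂ} {z : ℕ → ℂ}
    (hz : IsOrderedEigenvalues (transferMatrix R V T E) z) (hE : E ∉ degenerateSet R V T) :
    Function.Injective fun i : Fin L ⊕ Fin L => z (eigIndex i) := by
  have hnodup : (transferMatrix R V T E).charpoly.roots.Nodup := by
    rw [Multiset.nodup_iff_count_le_one]
    intro w
    rw [count_roots]
    by_contra! h
    exact hE ⟨w, h⟩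
  rw [hz.1, Icc_val_map_eq_univ_val_map] at hnodup
  intro i j hij
  exact Multiset.inj_on_of_nodup_map hnodup i (Finset.mem_univ i) j (Finset.mem_univ j) hij

theorem IsOrderedEigenvalues.mem_spectrum {M : Matrix (Fin L ⊕ Fin L) (Fin L ⊕ Fin L) ℂ}
    {z : ℕ → ℂ} (hz : IsOrderedEigenvalues M z) {l : ℕ} (hl : l ∈ Finset.Icc 1 (2 * L)) :
    z l ∈ spectrum ℂ M := by
  rw [Matrix.mem_spectrum_iff_isRoot_charpoly, ← mem_roots M.charpoly_monic.ne_zero, hz.1]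
  exact Multiset.mem_map_of_mem z hl

theorem derivative_prod_X_sub_C_eval_ne_zero {n : Type*} [Fintype n] {x : n → ℂ}
    (hinj : Function.Injective x) (k : n) :
    (derivative (∏ i, (X - C (x i)))).eval (x k) ≠ 0 := by
  classical
  rw [derivative_prod_finset, eval_finsetSum, Finset.sum_eq_single k]
  · simp only [derivative_sub, derivative_X, derivative_C, sub_zero, mul_one, eval_prod, eval_sub,
      eval_X, eval_C]
    exact Finset.prod_ne_zero_iff.mpr fun i hi =>
      sub_ne_zero.mpr (hinj.ne (Finset.ne_of_mem_erase hi).symm)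
  · intro j _ hj
    rw [eval_mul, eval_prod, Finset.prod_eq_zero (Finset.mem_erase.mpr ⟨hj.symm, Finset.mem_univ k⟩)
      (by simp), zero_mul]
  · simp

theorem exists_isAnalyticLabelling {E₀ : ℂ} {z : ℕ → ℂ}
    (hz : IsOrderedEigenvalues (transferMatrix R V T E₀) z) (hE₀ : E₀ ∉ degenerateSet R V T) :
    ∃ ζ, IsAnalyticLabelling R V T E₀ z ζ := by
  have hinj := hz.injective_of_notMem_degenerateSet hE₀
  have hp := charpoly_eq_prod_of_injective hinj fun i => hz.mem_spectrum (eigIndex_mem_Icc i)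
  have : ∀ l, ∃ ζ : ℂ → ℂ, l ∈ Finset.Icc 1 (2 * L) → ζ E₀ = z l ∧ AnalyticAt ℂ ζ E₀ ∧
      ∀ᶠ E in 𝓝 E₀, ζ E ∈ spectrum ℂ (transferMatrix R V T E) := by
    intro l
    by_cases hl : l ∈ Finset.Icc 1 (2 * L)
    · obtain ⟨i, _, rfl⟩ := Finset.mem_image.mp (image_eigIndex_univ (L := L) ▸ hl)
      obtain ⟨ζ, h1, h2, h3⟩ := exists_analyticAt_root (transferPoly R V T).charpoly
        (E₀ := E₀) (y₀ := z (eigIndex i))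
        (by
          rw [charpoly_transferPoly_map]
          exact Matrix.mem_spectrum_iff_isRoot_charpoly.mp (hz.mem_spectrum hl))
        (by
          rw [charpoly_transferPoly_map, hp]
          exact derivative_prod_X_sub_C_eval_ne_zero hinj i)
      refine ⟨ζ, fun _ => ⟨h1, h2, h3.mono fun E hE => ?_⟩⟩
      rw [Matrix.mem_spectrum_iff_isRoot_charpoly, ← charpoly_transferPoly_map]
      exact hE
    · exact ⟨0, fun h => absurd h hl⟩
  choose ζ hζ using this
  exact ⟨ζ, fun l hl => hζ l hl⟩

end Labelling

end BlockToeplitz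

/-! ### The determinant near a point of the boundary -/

namespace BlockToeplitz

open Polynomial Filter

variable {L : ℕ} {R V T : Matrix (Fin L) (Fin L) ℂ}

theorem IsAnalyticLabelling.eventually_injective {E₀ : ℂ} {z : ℕ → ℂ} {ζ : ℕ → ℂ → ℂ}
    (hz : IsOrderedEigenvalues (transferMatrix R V T E₀) z) (hE₀ : E₀ ∉ degenerateSet R V T)
    (hζ : IsAnalyticLabelling R V T E₀ z ζ) :
    ∀ᶠ E in 𝓝 E₀, Function.Injective fun i : Fin L ⊕ Fin L => ζ (eigIndex i) E := by
  have h : ∀ i j : Fin L ⊕ Fin L, ∀ᶠ E in 𝓝 E₀,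
      ζ (eigIndex i) E = ζ (eigIndex j) E → i = j := by
    intro i j
    obtain ⟨hi, hi', -⟩ := hζ _ (eigIndex_mem_Icc i)
    obtain ⟨hj, hj', -⟩ := hζ _ (eigIndex_mem_Icc j)
    by_cases hij : i = j
    · exact Eventually.of_forall fun _ _ => hij
    · have hne : ζ (eigIndex i) E₀ ≠ ζ (eigIndex j) E₀ := by
        rw [hi, hj]
        exact (hz.injective_of_notMem_degenerateSet hE₀).ne hij
      have hne' : ζ (eigIndex i) E₀ - ζ (eigIndex j) E₀ ≠ 0 := sub_ne_zero.mpr hne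
      filter_upwards [(hi'.continuousAt.sub hj'.continuousAt).eventually_ne hne'] with E hE hE'
      exact absurd (sub_eq_zero.mpr hE') hE
  filter_upwards [eventually_all.mpr fun i => eventually_all.mpr (h i)] with E hE i j hij
  exact hE i j hij

/-- The expansion of the determinant of the lower left block of `𝒯 ^ M` near an energy at which the
eigenvalues are simple. The coefficients `A S` are the functions `q_S`, which up to a product of
differences of eigenvalues are polynomials in the energy and the eigenvalues. -/
theorem exists_local_blockMinor {E₀ : ℂ} {x : Fin L ⊕ Fin L → ℂ → ℂ}
    (hcont : ∀ i, ContinuousAt (x i) E₀)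
    (hx : ∀ᶠ E in 𝓝 E₀, (Function.Injective fun i => x i E) ∧
      ∀ i, x i E ∈ spectrum ℂ (transferMatrix R V T E)) :
    ∃ A : Finset (Fin L ⊕ Fin L) → ℂ → ℂ,
      (∀ᶠ E in 𝓝 E₀, ∀ M : ℕ, ((transferMatrix R V T E) ^ M).toBlocks₂₁.det =
        ∑ I ∈ Finset.powersetCard L Finset.univ, (∏ i ∈ I, x i E) ^ M * A I E) ∧
      ∀ S : Finset (Fin L ⊕ Fin L), S.card = L →
        ContinuousAt (A S) E₀ ∧
        ∀ᶠ E in 𝓝 E₀, qFun R V T E (S.image fun i => x i E) = A S E ∧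
          A Sᶜ E = (-1) ^ L * A S E ∧
          (evalAt E (fun i => x i E) (blockPoly R V T S) = 0 ↔ A S E = 0) := by
  have hex : ∀ E, ∃ a : Finset (Fin L ⊕ Fin L) → ℂ, ((Function.Injective fun i => x i E) ∧
      ∀ i, x i E ∈ spectrum ℂ (transferMatrix R V T E)) →
      (∀ p : ℂ[X], (Polynomial.aeval (transferMatrix R V T E) p).toBlocks₂₁.det =
        ∑ I ∈ Finset.powersetCard L Finset.univ, (∏ i ∈ I, p.eval (x i E)) * a I) ∧
      (∀ S : Finset (Fin L ⊕ Fin L), S.card = L →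
        (rieszProjection (transferMatrix R V T E) (S.image fun i => x i E)).toBlocks₂₁.det = a S) ∧
      ∀ S : Finset (Fin L ⊕ Fin L), S.card = L → a Sᶜ = (-1) ^ L * a S := by
    intro E
    by_cases h : (Function.Injective fun i => x i E) ∧
      ∀ i, x i E ∈ spectrum ℂ (transferMatrix R V T E)
    · obtain ⟨a, ha⟩ := exists_blockMinor (transferMatrix R V T E) h.1 h.2
      exact ⟨a, fun _ => ha⟩
    · exact ⟨0, fun h' => absurd h' h⟩
  choose A hA using hex
  let D : Finset (Fin L ⊕ Fin L) → ℂ → ℂ := fun S E => ∏ i ∈ S, ∏ j ∈ Sᶜ, (x i E - x j E)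
  have hD0 : ∀ S E, (Function.Injective fun i => x i E) → D S E ≠ 0 := by
    intro S E hinj
    refine Finset.prod_ne_zero_iff.mpr fun i hi => Finset.prod_ne_zero_iff.mpr fun j hj => ?_
    refine sub_ne_zero.mpr (hinj.ne ?_)
    rintro rfl
    exact Finset.mem_compl.mp hj hi
  have hD : ∀ S, ContinuousAt (D S) E₀ := fun S =>
    tendsto_finsetProd _ fun i _ => tendsto_finsetProd _ fun j _ => (hcont i).sub (hcont j)
  have hG : ∀ S : Finset (Fin L ⊕ Fin L), S.card = L → ∀ᶠ E in 𝓝 E₀,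
      evalAt E (fun i => x i E) (blockPoly R V T S) = D S E * A E S := by
    intro S hS
    filter_upwards [hx] with E hE
    rw [evalAt_blockPoly, (hA E hE).1, Finset.sum_eq_single S]
    · simp [D, eval_prod]
    · intro I hI hne
      rw [prod_eq_zero_of_card_eq_of_ne ((Finset.mem_powersetCard.mp hI).2.trans hS.symm) _ hne,
        zero_mul]
      intro i hi
      rw [eval_prod]
      exact Finset.prod_eq_zero (Finset.mem_compl.mpr hi) (by simp)
    · intro h
      exact absurd (Finset.mem_powersetCard.mpr ⟨Finset.subset_univ S, hS⟩) h
  refine ⟨fun S E => A E S, ?_, fun S hS => ⟨?_, ?_⟩⟩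
  · filter_upwards [hx] with E hE M
    have h := (hA E hE).1 (X ^ M)
    rw [map_pow, aeval_X] at h
    rw [h]
    refine Finset.sum_congr rfl fun I _ => ?_
    simp [Finset.prod_pow]
  · have h1 : ContinuousAt (fun E => evalAt E (fun i => x i E) (blockPoly R V T S) / D S E) E₀ :=
      (continuousAt_evalAt hcont _).div (hD S) (hD0 S E₀ hx.self_of_nhds.1)
    refine h1.congr ?_
    filter_upwards [hx, hG S hS] with E hE hE'
    rw [hE', mul_div_cancel_left₀ _ (hD0 S E hE.1)]
  · filter_upwards [hx, hG S hS] with E hE hE'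
    refine ⟨(hA E hE).2.1 S hS, (hA E hE).2.2 S hS, ?_⟩
    rw [hE', mul_eq_zero, or_iff_right (hD0 S E hE.1)]

/-- If the quotient of the two middle eigenvalues were constant near `E₀`, with modulus one, then
`E₀` would be an interior point of `Λ`. -/
theorem not_eventually_deriv_div_eq_zero (hL : 1 ≤ L) {z : ℂ → ℕ → ℂ}
    (hz : ∀ E, IsOrderedEigenvalues (transferMatrix R V T E) (z E)) {E₀ : ℂ}
    (hfr : E₀ ∈ frontier (middleSet L z)) {x : Fin L ⊕ Fin L → ℂ → ℂ}
    (han : ∀ i, AnalyticAt ℂ (x i) E₀)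
    (hchar : ∀ᶠ E in 𝓝 E₀, (transferMatrix R V T E).charpoly = ∏ i, (X - C (x i E)))
    (hne : x (upperMiddle hL) E₀ ≠ 0)
    (hab : ‖x (lowerMiddle hL) E₀‖ = ‖x (upperMiddle hL) E₀‖)
    (hlow : ∀ i ∈ lowerLabels L, i ≠ lowerMiddle hL → ‖x i E₀‖ < ‖x (lowerMiddle hL) E₀‖)
    (hup : ∀ i ∉ lowerLabels L, i ≠ upperMiddle hL → ‖x (upperMiddle hL) E₀‖ < ‖x i E₀‖) :
    ¬ ∀ᶠ E in 𝓝 E₀, deriv (fun E' => x (lowerMiddle hL) E' / x (upperMiddle hL) E') E = 0 := by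
  intro hder
  have hw : AnalyticAt ℂ (fun E => x (lowerMiddle hL) E / x (upperMiddle hL) E) E₀ :=
    (han _).div (han _) hne
  have hcont : ∀ i, ContinuousAt (fun E => ‖x i E‖) E₀ := fun i => (han i).continuousAt.norm
  have hconst : ∀ᶠ E in 𝓝 E₀, x (lowerMiddle hL) E / x (upperMiddle hL) E =
      x (lowerMiddle hL) E₀ / x (upperMiddle hL) E₀ := by
    obtain ⟨r, hr, hball⟩ := Metric.eventually_nhds_iff_ball.mp
      (hder.and hw.eventually_analyticAt)
    filter_upwards [Metric.ball_mem_nhds E₀ hr] with E hE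
    exact Metric.isOpen_ball.is_const_of_deriv_eq_zero (convex_ball _ _).isPreconnected
      (fun y hy => (hball y hy).2.differentiableAt.differentiableWithinAt)
      (fun y hy => (hball y hy).1) hE (Metric.mem_ball_self hr)
  have hlow' : ∀ i, ∀ᶠ E in 𝓝 E₀, i ∈ lowerLabels L → ‖x i E‖ ≤ ‖x (lowerMiddle hL) E‖ := by
    intro i
    by_cases hi : i ∈ lowerLabels L ∧ i ≠ lowerMiddle hL
    · filter_upwards [(hcont i).eventually_lt (hcont _) (hlow i hi.1 hi.2)] with E hE _
      exact hE.le
    · refine Eventually.of_forall fun E hi' => ?_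
      rw [not_not.mp fun h => hi ⟨hi', h⟩]
  have hup' : ∀ i, ∀ᶠ E in 𝓝 E₀, i ∉ lowerLabels L → ‖x (upperMiddle hL) E‖ ≤ ‖x i E‖ := by
    intro i
    by_cases hi : i ∉ lowerLabels L ∧ i ≠ upperMiddle hL
    · filter_upwards [(hcont _).eventually_lt (hcont i) (hup i hi.1 hi.2)] with E hE _
      exact hE.le
    · refine Eventually.of_forall fun E hi' => ?_
      rw [not_not.mp fun h => hi ⟨hi', h⟩]
  refine hfr.2 (mem_interior_iff_mem_nhds.mpr ?_)
  filter_upwards [hconst, hchar, eventually_all.mpr hlow', eventually_all.mpr hup',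
    (han (upperMiddle hL)).continuousAt.eventually_ne hne] with E h1 h2 h3 h4 h5
  have hEab : ‖x (lowerMiddle hL) E‖ = ‖x (upperMiddle hL) E‖ := by
    have h := congrArg norm h1
    rw [norm_div, norm_div, hab, div_self (norm_ne_zero_iff.mpr hne)] at h
    exact (div_eq_one_iff_eq (norm_ne_zero_iff.mpr h5)).mp h
  exact (hz E).norm_middle_eq hL h2 h3 (fun i hi => hEab ▸ h4 i hi) rfl hEab.symm

/-- Near an energy with exactly two dominant products of `L` eigenvalues, which have the same
modulus and a non-stationary quotient, the determinant of the lower left block of `𝒯 ^ M` has a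
zero at distance `O(1 / M)`. -/
theorem exists_zero_det_toBlocks₂₁_pow (hL : 1 ≤ L) {E₀ : ℂ} {x : Fin L ⊕ Fin L → ℂ → ℂ}
    {A : Finset (Fin L ⊕ Fin L) → ℂ → ℂ}
    (han : ∀ i, AnalyticAt ℂ (x i) E₀) (hne : ∀ i, x i E₀ ≠ 0)
    (hab : ‖x (lowerMiddle hL) E₀‖ = ‖x (upperMiddle hL) E₀‖)
    (hlow : ∀ i ∈ lowerLabels L, i ≠ lowerMiddle hL → ‖x i E₀‖ < ‖x (lowerMiddle hL) E₀‖)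
    (hup : ∀ i ∉ lowerLabels L, i ≠ upperMiddle hL → ‖x (upperMiddle hL) E₀‖ < ‖x i E₀‖)
    (hder : deriv (fun E' => x (lowerMiddle hL) E' / x (upperMiddle hL) E') E₀ ≠ 0)
    (hexp : ∀ᶠ E in 𝓝 E₀, ∀ M : ℕ, ((transferMatrix R V T E) ^ M).toBlocks₂₁.det =
        ∑ I ∈ Finset.powersetCard L Finset.univ, (∏ i ∈ I, x i E) ^ M * A I E)
    (hcont : ∀ S : Finset (Fin L ⊕ Fin L), S.card = L → ContinuousAt (A S) E₀)
    (hA₀ : A (lowerLabels L)ᶜ E₀ ≠ 0) (hA₁ : A (exchangedLabels hL)ᶜ E₀ ≠ 0) :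
    ∃ C : ℝ, 0 < C ∧ ∃ M₀ : ℕ, ∀ M : ℕ, M₀ ≤ M → ∃ ε : ℂ, ‖ε‖ ≤ C / (M : ℝ) ∧
      ((transferMatrix R V T (E₀ + ε)) ^ M).toBlocks₂₁.det = 0 := by
  classical
  set J := (lowerLabels L)ᶜ with hJ
  set J' := (exchangedLabels hL)ᶜ with hJ'
  have haJ : lowerMiddle hL ∉ J := fun h => Finset.mem_compl.mp h (lowerMiddle_mem hL)
  have hbJ : upperMiddle hL ∈ J := Finset.mem_compl.mpr (upperMiddle_notMem hL)
  have hJ'eq : J' = insert (lowerMiddle hL) (J.erase (upperMiddle hL)) := compl_exchangedLabels hL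
  have hJcard : J.card = L := card_compl_lowerLabels
  have hJ'card : J'.card = L := by
    rw [hJ', Finset.card_compl, card_exchangedLabels]
    simp
  have hJJ' : J' ≠ J := by
    intro h
    apply haJ
    rw [← h, hJ'eq]
    exact Finset.mem_insert_self _ _
  let P : Finset (Fin L ⊕ Fin L) → ℂ → ℂ := fun I E => ∏ i ∈ I, x i E
  have hPan : ∀ I, AnalyticAt ℂ (P I) E₀ := fun I =>
    Finset.analyticAt_fun_prod I fun i _ => han i
  have hP0 : P J E₀ ≠ 0 := Finset.prod_ne_zero_iff.mpr fun i _ => hne i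
  have hPne : ∀ᶠ E in 𝓝 E₀, ∀ i, x i E ≠ 0 :=
    eventually_all.mpr fun i => (han i).continuousAt.eventually_ne (hne i)
  have hPJ' : ∀ᶠ E in 𝓝 E₀, P J' E / P J E = x (lowerMiddle hL) E / x (upperMiddle hL) E := by
    filter_upwards [hPne] with E hE
    simp only [P]
    rw [hJ'eq, Finset.prod_insert (fun h => haJ (Finset.mem_of_mem_erase h)),
      ← Finset.mul_prod_erase J _ hbJ]
    refine mul_div_mul_right _ _ (Finset.prod_ne_zero_iff.mpr fun i _ => hE i)
  have hsmall : ∀ I : Finset (Fin L ⊕ Fin L), I.card = L → I ≠ J → I ≠ J' →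
      ‖P I E₀ / P J E₀‖ < 1 := by
    intro I hI h1 h2
    rw [norm_div, div_lt_one (norm_pos_iff.mpr hP0)]
    simp only [P, norm_prod]
    refine prod_lt_prod_of_dominant (ρ := ‖x (upperMiddle hL) E₀‖)
      (fun i => norm_pos_iff.mpr (hne i)) (norm_pos_iff.mpr (hne _)) hbJ ?_ ?_ ?_ ?_
      (hI.trans hJcard.symm) h1 (hJ'eq ▸ h2)
    · intro i hi
      rw [hJ, Finset.mem_compl, not_not] at hi
      rcases eq_or_ne i (lowerMiddle hL) with rfl | hia
      · exact hab.le
      · exact hab ▸ (hlow i hi hia).le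
    · intro i hi hia
      rw [hJ, Finset.mem_compl, not_not] at hi
      exact hab ▸ hlow i hi hia
    · intro i hi
      rcases eq_or_ne i (upperMiddle hL) with rfl | hib
      · exact le_rfl
      · exact (hup i (Finset.mem_compl.mp hi) hib).le
    · intro i hi hib
      exact hup i (Finset.mem_compl.mp hi) hib
  let K := ((Finset.powersetCard L (Finset.univ : Finset (Fin L ⊕ Fin L))).erase J).erase J'
  have hKmem : ∀ I ∈ K, I.card = L ∧ I ≠ J ∧ I ≠ J' := by
    intro I hI
    simp only [K, Finset.mem_erase, Finset.mem_powersetCard] at hI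
    exact ⟨hI.2.2.2, hI.2.1, hI.1⟩
  have hrem : Tendsto (fun p : ℕ × ℂ => ∑ I ∈ K, (P I p.2 / P J p.2) ^ p.1 * A I p.2)
      (atTop ×ˢ 𝓝 E₀) (𝓝 0) := by
    rw [← Finset.sum_const_zero (s := K)]
    refine tendsto_finsetSum _ fun I hI => ?_
    obtain ⟨hcard, h1, h2⟩ := hKmem I hI
    obtain ⟨q, hq1, hq2⟩ := exists_between (hsmall I hcard h1 h2)
    have hq0 : 0 ≤ q := (norm_nonneg _).trans hq1.le
    have hratio : ∀ᶠ E in 𝓝 E₀, ‖P I E / P J E‖ < q :=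
      (((hPan I).continuousAt.div (hPan J).continuousAt hP0).norm).eventually_lt_const hq1
    have hpow : Tendsto (fun p : ℕ × ℂ => (P I p.2 / P J p.2) ^ p.1) (atTop ×ˢ 𝓝 E₀) (𝓝 0) := by
      refine squeeze_zero_norm' ?_
        ((tendsto_pow_atTop_nhds_zero_of_lt_one hq0 hq2).comp tendsto_fst)
      filter_upwards [tendsto_snd.eventually hratio] with p hp
      rw [norm_pow]
      exact pow_le_pow_left₀ (norm_nonneg _) hp.le _
    have := hpow.mul ((hcont I hcard).tendsto.comp (tendsto_snd (f := (atTop : Filter ℕ))))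
    rwa [zero_mul] at this
  have hmain : ∀ᶠ E in 𝓝 E₀, ∀ M : ℕ,
      ((transferMatrix R V T E) ^ M).toBlocks₂₁.det / P J E ^ M =
        (A J E + (x (lowerMiddle hL) E / x (upperMiddle hL) E) ^ M * A J' E) +
          ∑ I ∈ K, (P I E / P J E) ^ M * A I E := by
    filter_upwards [hexp, hPJ', hPne] with E h1 h2 h3 M
    have hJE : P J E ≠ 0 := Finset.prod_ne_zero_iff.mpr fun i _ => h3 i
    rw [h1, Finset.sum_div, ← Finset.add_sum_erase _ _ (Finset.mem_powersetCard.mpr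
      ⟨Finset.subset_univ J, hJcard⟩), ← Finset.add_sum_erase _ _ (Finset.mem_erase.mpr
      ⟨hJJ', Finset.mem_powersetCard.mpr ⟨Finset.subset_univ J', hJ'card⟩⟩), ← add_assoc, ← h2]
    congr 1
    · congr 1
      · exact mul_div_cancel_left₀ _ (pow_ne_zero M hJE)
      · rw [div_pow, mul_div_right_comm]
    · refine Finset.sum_congr rfl fun I _ => ?_
      rw [div_pow, mul_div_right_comm]
  have hw := ((han (lowerMiddle hL)).div (han (upperMiddle hL)) (hne _)).differentiableAt.hasDerivAt
  obtain ⟨C, hC, M₀, hzero⟩ := exists_zero_near_of_two_dominant_terms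
    (F := fun M E => ((transferMatrix R V T E) ^ M).toBlocks₂₁.det / P J E ^ M)
    (a := A J) (b := A J') (w := fun E => x (lowerMiddle hL) E / x (upperMiddle hL) E) (E₀ := E₀)
    (by
      filter_upwards [(hPan J).eventually_analyticAt, (hPan J).continuousAt.eventually_ne hP0]
        with E h1 h2 M
      exact (differentiable_det_toBlocks₂₁_pow R V T M E).div (h1.differentiableAt.pow M)
        (pow_ne_zero M h2))
    (by
      refine hrem.congr' ?_
      filter_upwards [(tendsto_snd (f := (atTop : Filter ℕ))).eventually hmain] with p hp
      rw [hp, add_sub_cancel_left])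
    (hcont J hJcard) (hcont J' hJ'card) hA₀ hA₁
    (by rw [norm_div, hab, div_self (norm_ne_zero_iff.mpr (hne _))]) hw hder
  -- The common denominator `P J` does not vanish at the zeros that have been found.
  obtain ⟨r, hr, hball⟩ := Metric.eventually_nhds_iff_ball.mp
    ((hPan J).continuousAt.eventually_ne hP0)
  obtain ⟨M₁, hM₁⟩ := eventually_atTop.mp
    ((tendsto_const_div_atTop_nhds_zero_nat C).eventually_lt_const hr)
  refine ⟨C, hC, max M₀ M₁, fun M hM => ?_⟩
  obtain ⟨ε, hε, h0⟩ := hzero M ((le_max_left _ _).trans hM)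
  refine ⟨ε, hε, ?_⟩
  have hmem : E₀ + ε ∈ Metric.ball E₀ r := by
    rw [Metric.mem_ball, dist_eq_norm, add_sub_cancel_left]
    exact hε.trans_lt (hM₁ M ((le_max_right _ _).trans hM))
  exact (div_eq_zero_iff.mp h0).resolve_right (pow_ne_zero M (hball _ hmem))

end BlockToeplitz

theorem mainTheorem5 {L : ℕ} (hL : 1 ≤ L) (R V T : Matrix (Fin L) (Fin L) ℂ)
    (z : ℂ → ℕ → ℂ)
    (hz : ∀ E : ℂ, BlockToeplitz.IsOrderedEigenvalues
      (BlockToeplitz.transferMatrix R V T E) (z E))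
    (hA : BlockToeplitz.HypothesisA R T)
    (hB : BlockToeplitz.HypothesisB R V T)
    (hC : BlockToeplitz.HypothesisC L z)
    (hD : BlockToeplitz.HypothesisD R V T z) :
    {E : ℂ | E ∈ frontier (BlockToeplitz.middleSet L z) ∧
      ¬ ∃ C : ℝ, 0 < C ∧ ∃ N₀ : ℕ, ∀ N : ℕ, N₀ ≤ N →
        ∃ ε : ℂ, ‖ε‖ ≤ C / (N : ℝ) ∧
          E + ε ∈ spectrum ℂ (BlockToeplitz.finiteHam R V T N)}.Finite := by
  open BlockToeplitz Filter in
  set p := (transferPoly R V T).charpoly with hp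
  obtain ⟨B₀, hB₀, hG₀⟩ := exists_finite_forall_eventually_evalAt_eq_zero p
    (blockPoly R V T (lowerLabels L))
  obtain ⟨B₁, hB₁, hG₁⟩ := exists_finite_forall_eventually_evalAt_eq_zero p
    (blockPoly R V T (exchangedLabels hL))
  obtain ⟨G, hG⟩ := exists_evalAt_eq_zero_iff_deriv_div_eq_zero p (lowerMiddle hL) (upperMiddle hL)
  obtain ⟨B₂, hB₂, hG₂⟩ := exists_finite_forall_eventually_evalAt_eq_zero p G
  refine (((((hB.union hC).union hB₀).union hB₁).union hB₂)).subset ?_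
  rintro E₀ ⟨hfr, hno⟩
  by_contra hbad
  simp only [Set.mem_union, not_or] at hbad
  obtain ⟨⟨⟨⟨hF, hE₀C⟩, hE₀0⟩, hE₀1⟩, hE₀2⟩ := hbad
  apply hno
  have hgap := not_not.mp fun h => hE₀C ⟨hfr, h⟩
  obtain ⟨hgap₁, hmid, hgap₂⟩ := hgap
  obtain ⟨ζ, hζ⟩ := exists_isAnalyticLabelling (hz E₀) hF
  let x : Fin L ⊕ Fin L → ℂ → ℂ := fun i => ζ (eigIndex i)
  have hx₀ : ∀ i, x i E₀ = z E₀ (eigIndex i) := fun i => (hζ _ (eigIndex_mem_Icc i)).1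
  have han : ∀ i, AnalyticAt ℂ (x i) E₀ := fun i => (hζ _ (eigIndex_mem_Icc i)).2.1
  have hcont : ∀ i, ContinuousAt (x i) E₀ := fun i => (han i).continuousAt
  have hx : ∀ᶠ E in 𝓝 E₀, (Function.Injective fun i => x i E) ∧
      ∀ i, x i E ∈ spectrum ℂ (transferMatrix R V T E) :=
    (hζ.eventually_injective (hz E₀) hF).and
      (eventually_all.mpr fun i => (hζ _ (eigIndex_mem_Icc i)).2.2)
  have hchar : ∀ᶠ E in 𝓝 E₀, (transferMatrix R V T E).charpoly =
      ∏ i, (Polynomial.X - Polynomial.C (x i E)) :=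
    hx.mono fun E hE => charpoly_eq_prod_of_injective hE.1 hE.2
  have hpx : ∀ᶠ E in 𝓝 E₀, p.map (Polynomial.evalRingHom E) =
      ∏ i, (Polynomial.X - Polynomial.C (x i E)) :=
    hchar.mono fun E hE => by rw [hp, charpoly_transferPoly_map, hE]
  have hne : ∀ i, x i E₀ ≠ 0 := fun i h =>
    zero_notMem_spectrum_transferMatrix V hA E₀ (h ▸ hx.self_of_nhds.2 i)
  have hab : ‖x (lowerMiddle hL) E₀‖ = ‖x (upperMiddle hL) E₀‖ := by
    rw [hx₀, hx₀, eigIndex_lowerMiddle, eigIndex_upperMiddle, hmid]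
  have hlow : ∀ i ∈ lowerLabels L, i ≠ lowerMiddle hL →
      ‖x i E₀‖ < ‖x (lowerMiddle hL) E₀‖ := by
    intro i hi hia
    rw [hx₀, hx₀, eigIndex_lowerMiddle]
    have h1 := (mem_lowerLabels i).mp hi
    have h2 := (Finset.mem_Icc.mp (eigIndex_mem_Icc i)).1
    have h3 : eigIndex i ≠ L := fun h =>
      hia (eigIndex_injective (h.trans (eigIndex_lowerMiddle hL).symm))
    exact ((hz E₀).norm_mono h2 (by omega) (by omega)).trans_lt (hgap₁ (by omega))
  have hup : ∀ i ∉ lowerLabels L, i ≠ upperMiddle hL →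
      ‖x (upperMiddle hL) E₀‖ < ‖x i E₀‖ := by
    intro i hi hib
    rw [hx₀, hx₀, eigIndex_upperMiddle]
    have h1 := (mem_lowerLabels i).not.mp hi
    have h2 := (Finset.mem_Icc.mp (eigIndex_mem_Icc i)).2
    have h3 : eigIndex i ≠ L + 1 := fun h =>
      hib (eigIndex_injective (h.trans (eigIndex_upperMiddle hL).symm))
    exact (hgap₂ (by omega)).trans_le ((hz E₀).norm_mono (by omega) (by omega) h2)
  obtain ⟨A, hexp, hAS⟩ := exists_local_blockMinor hcont hx
  -- If `q_S` vanished at `E₀`, then, `E₀` not being exceptional, it would vanish near `E₀`.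
  have hAne : ∀ S : Finset (Fin L ⊕ Fin L), S.card = L →
      (evalAt E₀ (fun i => x i E₀) (blockPoly R V T S) = 0 →
        ∀ᶠ E in 𝓝 E₀, evalAt E (fun i => x i E) (blockPoly R V T S) = 0) →
      (¬ ∀ᶠ E in 𝓝 E₀, qFun R V T E ((S.image eigIndex).image fun l => ζ l E) = 0) →
        A Sᶜ E₀ ≠ 0 := by
    intro S hS hGS hq h0
    obtain ⟨-, hcompl, hiff⟩ := (hAS S hS).2.self_of_nhds
    have hAS₀ : A S E₀ = 0 :=
      (mul_eq_zero.mp (hcompl ▸ h0)).resolve_left (pow_ne_zero L (neg_ne_zero.mpr one_ne_zero))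
    apply hq
    filter_upwards [hGS (hiff.mpr hAS₀), (hAS S hS).2] with E h1 h2
    rw [Finset.image_image]
    exact h2.1.trans (h2.2.2.mp h1)
  have hqD := hD E₀ ⟨hfr, hF⟩ ζ hζ
  have hA₀ := hAne _ card_lowerLabels (hG₀ E₀ hE₀0 x hcont hpx)
    (by rw [image_eigIndex_lowerLabels]; exact hqD.1)
  have hA₁ := hAne _ (card_exchangedLabels hL) (hG₁ E₀ hE₀1 x hcont hpx)
    (by rw [image_eigIndex_exchangedLabels]; exact hqD.2)
  have hiff : ∀ᶠ E in 𝓝 E₀, (evalAt E (fun k => x k E) G = 0 ↔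
      deriv (fun E' => x (lowerMiddle hL) E' / x (upperMiddle hL) E') E = 0) := by
    filter_upwards [eventually_all.mpr fun i => (han i).eventually_analyticAt,
      hpx.eventually_nhds, hx, hcont (upperMiddle hL) |>.eventually_ne (hne _)] with E h1 h2 h3 h4
    refine hG E x (fun k => (h1 k).differentiableAt) (fun k => h2.mono fun E' hE' => ?_)
      (fun k => ?_) h4
    · rw [hE', Polynomial.eval_prod]
      exact Finset.prod_eq_zero (Finset.mem_univ k) (by simp)
    · rw [h2.self_of_nhds]
      exact derivative_prod_X_sub_C_eval_ne_zero h3.1 k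
  have hder : deriv (fun E' => x (lowerMiddle hL) E' / x (upperMiddle hL) E') E₀ ≠ 0 := by
    intro h0
    refine not_eventually_deriv_div_eq_zero hL hz hfr han hchar (hne _) hab hlow hup ?_
    filter_upwards [hiff, hG₂ E₀ hE₀2 x hcont hpx (hiff.self_of_nhds.mpr h0)] with E h1 h2
    exact h1.mp h2
  obtain ⟨C, hC0, M₀, hzero⟩ := exists_zero_det_toBlocks₂₁_pow hL han hne hab hlow hup hder hexp
    (fun S hS => (hAS S hS).1) hA₀ hA₁
  refine ⟨C, hC0, max 1 M₀, fun N hN => ?_⟩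
  have hN1 : 1 ≤ N := (le_max_left _ _).trans hN
  obtain ⟨ε, hε, hdet⟩ := hzero (N + 1) (((le_max_right _ _).trans hN).trans N.le_succ)
  refine ⟨ε, hε.trans ?_, mem_spectrum_finiteHam hA.1 hN1 hdet⟩
  have : (0 : ℝ) < N := Nat.cast_pos.mpr hN1
  gcongr
  exact N.le_succ
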